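/- Let $n$ be a non-zero integer. For an integer $m\ge 2$, a $D(n)$-$m$-tuple is a set of $m$ distinct positive integers such that the product of any two distinct elements, increased by $n$, is a perfect square ($0$ counts as a perfect square); $D(n)$-pairs and $D(n)$-triples are the cases $m=2$ and $m=3$. A $D(n)$-triple $\{a,b,c\}$ with $a<b<c$ is called regular if $c=a+b+2r$, where $r\ge 0$ and $r^2=ab+n$, and irregular otherwise. Let $D_{m,n}(N)$ denote the number of $D(n)$-$m$-tuples contained in $\{1,2,\dots,N\}$, and let $D^{\mathrm{reg}}_{3,n}(N)$ and $D^{\mathrm{irr}}_{3,n}(N)$ denote the numbers of regular and of irregular $D(n)$-triples contained in $\{1,2,\dots,N\}$. Then, as $N\to\infty$, \[ D_{3,n}(N)\sim D^{\mathrm{reg}}_{3,n}(N)\sim \frac{D_{2,n}(N)}{2}, \] in particular $D_{3,n}(N)\sim \frac{D_{2,n}(N)}{2}$, and moreover \[ D^{\mathrm{irr}}_{3,n}(N)=O\left(N^{0.52}\right), \] where the implied constant may depend on $n$. -/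

import Mathlib

namespace DTuples

/-- `S` is a `D(q)`-`m`-tuple: a set of `m` distinct positive integers such that the product
of any two distinct elements, increased by `q`, is a perfect square. -/
def IsDTuple (q : ℤ) (m : ℕ) (S : Finset ℕ) : Prop :=
  S.card = m ∧ (∀ a ∈ S, 0 < a) ∧
    ∀ a ∈ S, ∀ b ∈ S, a ≠ b → IsSquare ((a : ℤ) * (b : ℤ) + q)

/-- A regular `D(n)`-triple: a `D(n)`-triple `{a, b, c}`, `a < b < c`, with `c = a + b + 2r`,
where `r` is the non-negative square root of `ab + n`. -/
def IsRegularTriple (n : ℤ) (S : Finset ℕ) : Prop :=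
  IsDTuple n 3 S ∧
    ∃ (a b c : ℕ) (r : ℤ), a < b ∧ b < c ∧ S = {a, b, c} ∧
      0 ≤ r ∧ r ^ 2 = (a : ℤ) * (b : ℤ) + n ∧ (c : ℤ) = (a : ℤ) + (b : ℤ) + 2 * r

/-- An irregular `D(n)`-triple: a `D(n)`-triple that is not regular. -/
def IsIrregularTriple (n : ℤ) (S : Finset ℕ) : Prop :=
  IsDTuple n 3 S ∧ ¬ IsRegularTriple n S

open Classical in
/-- The number of `D(q)`-`m`-tuples contained in `{1, …, N}`. -/
noncomputable def tupleCount (m : ℕ) (q : ℤ) (N : ℕ) : ℕ :=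
  ((Finset.Icc 1 N).powerset.filter (fun S => IsDTuple q m S)).card

open Classical in
/-- The number of regular `D(n)`-triples contained in `{1, …, N}`. -/
noncomputable def regularTripleCount (n : ℤ) (N : ℕ) : ℕ :=
  ((Finset.Icc 1 N).powerset.filter (fun S => IsRegularTriple n S)).card

open Classical in
/-- The number of irregular `D(n)`-triples contained in `{1, …, N}`. -/
noncomputable def irregularTripleCount (n : ℤ) (N : ℕ) : ℕ :=
  ((Finset.Icc 1 N).powerset.filter (fun S => IsIrregularTriple n S)).card

end DTuples

/-! Regular triples mirror pairs. If `c = a + b + 2r` with `r² = ab + n`, then `ac + n = (a + r)²`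
and `bc + n = (b + r)²`, so the triple gives the pairs `{a, c}` and `{b, c}`. Conversely a pair `x <
c` with root `s` has the companion `y = x + c - 2s`, and `{x, y, c}` is regular unless `c` is
bounded or `y = 0`. The latter means `(c - x)² = 4n`, which needs `n` square and happens at most `N`
times. Hence `D₂ = 2·Dreg + O(1)`, plus `O(N)` when `n` is a square (`two_mul_card_regSet_le`,
`card_pairSet_le`).

These errors are negligible because pairs are numerous. For every `n`, Brahmagupta's identity turns
coprime `(p, q)` into pairs and gives `D₂ ≫ N` (`card_pairSet_ge`). For `n = k²`, factorizations
attached to primes give about `N ∑ 1/p` pairs, which exceeds every multiple of `N`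
(`eventually_mul_le_card_pairSet`).

For irregular triples let `r, s, t` be the roots of `ab + n`, `ac + n`, `bc + n` and put `e = n(a +
b + c) + 2abc - 2rst`. Its product with the conjugate (sign of `rst` reversed) is `n²((c - a - b)² -
4r²)`. So for large `c` irregularity forces `e ≥ 1` and `abe ≤ 2n²c`, while `be + n²` is a square
(`descent_bounds`). Each `(a, b, e)` comes from at most two `c`. Counting such `(a, b, e)` uses the
divisor bound and square roots modulo `b`, and yields `O(N^(1/2 + 3ε))` (`sum_card_extensions_le`).
-/

namespace DTuples

open Finset

/-! ### Tuples as increasing sequences -/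

open Classical in
/-- Ordered `D(n)`-pairs in `{1, …, N}`. -/
noncomputable def pairSet (n : ℤ) (N : ℕ) : Finset (ℕ × ℕ) :=
  (Icc 1 N ×ˢ Icc 1 N).filter (fun p => p.1 < p.2 ∧ IsSquare ((p.1 : ℤ) * (p.2 : ℤ) + n))

open Classical in
/-- Increasing regular `D(n)`-triples in `{1, …, N}`. -/
noncomputable def regSet (n : ℤ) (N : ℕ) : Finset (ℕ × ℕ × ℕ) :=
  (Icc 1 N ×ˢ Icc 1 N ×ˢ Icc 1 N).filter (fun p => p.1 < p.2.1 ∧ p.2.1 < p.2.2 ∧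
    ∃ r : ℤ, 0 ≤ r ∧ r ^ 2 = (p.1 : ℤ) * (p.2.1 : ℤ) + n ∧
      (p.2.2 : ℤ) = (p.1 : ℤ) + (p.2.1 : ℤ) + 2 * r)

open Classical in
/-- Increasing irregular `D(n)`-triples in `{1, …, N}`. -/
noncomputable def irrSet (n : ℤ) (N : ℕ) : Finset (ℕ × ℕ × ℕ) :=
  (Icc 1 N ×ˢ Icc 1 N ×ˢ Icc 1 N).filter (fun p => p.1 < p.2.1 ∧ p.2.1 < p.2.2 ∧
    IsSquare ((p.1 : ℤ) * (p.2.1 : ℤ) + n) ∧ IsSquare ((p.1 : ℤ) * (p.2.2 : ℤ) + n) ∧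
    IsSquare ((p.2.1 : ℤ) * (p.2.2 : ℤ) + n) ∧
    ¬ ∃ r : ℤ, 0 ≤ r ∧ r ^ 2 = (p.1 : ℤ) * (p.2.1 : ℤ) + n ∧
      (p.2.2 : ℤ) = (p.1 : ℤ) + (p.2.1 : ℤ) + 2 * r)

theorem mem_pairSet {n : ℤ} {N x c : ℕ} : (x, c) ∈ pairSet n N ↔
    0 < x ∧ x < c ∧ c ≤ N ∧ IsSquare ((x : ℤ) * (c : ℤ) + n) := by
  simp only [pairSet, mem_filter, mem_product, mem_Icc]
  constructor
  · rintro ⟨⟨⟨h1, h2⟩, h3, h4⟩, h5, h6⟩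
    exact ⟨by omega, h5, h4, h6⟩
  · rintro ⟨h1, h2, h3, h4⟩
    exact ⟨⟨⟨by omega, by omega⟩, by omega, h3⟩, h2, h4⟩

theorem mem_regSet {n : ℤ} {N a b c : ℕ} : (a, b, c) ∈ regSet n N ↔
    0 < a ∧ a < b ∧ b < c ∧ c ≤ N ∧ ∃ r : ℤ, 0 ≤ r ∧ r ^ 2 = (a : ℤ) * (b : ℤ) + n ∧
      (c : ℤ) = (a : ℤ) + (b : ℤ) + 2 * r := by
  simp only [regSet, mem_filter, mem_product, mem_Icc]
  constructor
  · rintro ⟨⟨h1, h2, h3⟩, h4, h5, h6⟩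
    exact ⟨by omega, h4, h5, h3.2, h6⟩
  · rintro ⟨h1, h2, h3, h4, h5⟩
    exact ⟨⟨⟨by omega, by omega⟩, ⟨by omega, by omega⟩, by omega, h4⟩, h2, h3, h5⟩

theorem mem_irrSet {n : ℤ} {N a b c : ℕ} : (a, b, c) ∈ irrSet n N ↔
    0 < a ∧ a < b ∧ b < c ∧ c ≤ N ∧ IsSquare ((a : ℤ) * (b : ℤ) + n) ∧
    IsSquare ((a : ℤ) * (c : ℤ) + n) ∧ IsSquare ((b : ℤ) * (c : ℤ) + n) ∧
    ¬ ∃ r : ℤ, 0 ≤ r ∧ r ^ 2 = (a : ℤ) * (b : ℤ) + n ∧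
      (c : ℤ) = (a : ℤ) + (b : ℤ) + 2 * r := by
  simp only [irrSet, mem_filter, mem_product, mem_Icc]
  constructor
  · rintro ⟨⟨h1, h2, h3⟩, h4, h5, h6⟩
    exact ⟨by omega, h4, h5, h3.2, h6⟩
  · rintro ⟨h1, h2, h3, h4, h5⟩
    exact ⟨⟨⟨by omega, by omega⟩, ⟨by omega, by omega⟩, by omega, h4⟩, h2, h3, h5⟩

theorem pair_eq_of_lt {a b a' b' : ℕ} (h1 : a < b) (h2 : a' < b')
    (h : ({a, b} : Finset ℕ) = {a', b'}) : a = a' ∧ b = b' := by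
  have h' : ∀ x, (x = a ∨ x = b) ↔ (x = a' ∨ x = b') := fun x => by
    simpa using congrArg (fun S => x ∈ S) h
  have := h' a
  have := h' b
  have := h' a'
  have := h' b'
  omega

theorem triple_eq_of_lt {a b c a' b' c' : ℕ} (h1 : a < b) (h2 : b < c) (h3 : a' < b')
    (h4 : b' < c') (h : ({a, b, c} : Finset ℕ) = {a', b', c'}) : a = a' ∧ b = b' ∧ c = c' := by
  have h' : ∀ x, (x = a ∨ x = b ∨ x = c) ↔ (x = a' ∨ x = b' ∨ x = c') := fun x => by
    simpa using congrArg (fun S => x ∈ S) h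
  have := h' a
  have := h' b
  have := h' c
  have := h' a'
  have := h' b'
  have := h' c'
  omega

theorem exists_lt_of_card_eq_two {S : Finset ℕ} (h : S.card = 2) : ∃ a b, a < b ∧ S = {a, b} := by
  obtain ⟨a, b, hab, rfl⟩ := card_eq_two.1 h
  rcases lt_or_gt_of_ne hab with h | h
  · exact ⟨a, b, h, rfl⟩
  · exact ⟨b, a, h, pair_comm a b⟩

theorem exists_lt_of_card_eq_three {S : Finset ℕ} (h : S.card = 3) :
    ∃ a b c, a < b ∧ b < c ∧ S = {a, b, c} := by
  obtain ⟨a, b, c, hab, hac, hbc, rfl⟩ := card_eq_three.1 h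
  have key : ∀ x y z : ℕ, ((x = a ∨ x = b ∨ x = c) ∧ (y = a ∨ y = b ∨ y = c) ∧
      (z = a ∨ z = b ∨ z = c)) → x < y → y < z →
      ∃ x y z : ℕ, x < y ∧ y < z ∧ ({a, b, c} : Finset ℕ) = {x, y, z} := by
    intro x y z h hxy hyz
    refine ⟨x, y, z, hxy, hyz, ?_⟩
    ext w
    simp only [mem_insert, mem_singleton]
    omega
  rcases lt_or_gt_of_ne hab with h1 | h1 <;> rcases lt_or_gt_of_ne hac with h2 | h2 <;>
    rcases lt_or_gt_of_ne hbc with h3 | h3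
  · exact key a b c (by omega) h1 h3
  · exact key a c b (by omega) h2 h3
  · omega
  · exact key c a b (by omega) h2 h1
  · exact key b a c (by omega) h1 h2
  · omega
  · exact key b c a (by omega) h3 h2
  · exact key c b a (by omega) h3 h1

theorem isDTuple_pair {n : ℤ} {a b : ℕ} (hab : a < b) : IsDTuple n 2 {a, b} ↔
    0 < a ∧ IsSquare ((a : ℤ) * (b : ℤ) + n) := by
  constructor
  · rintro ⟨-, h1, h2⟩
    exact ⟨h1 a (by simp), h2 a (by simp) b (by simp) hab.ne⟩
  · rintro ⟨h1, h2⟩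
    refine ⟨card_pair hab.ne, ?_, ?_⟩
    · intro x hx
      simp only [mem_insert, mem_singleton] at hx
      omega
    · intro x hx y hy hxy
      simp only [mem_insert, mem_singleton] at hx hy
      rcases hx with rfl | rfl <;> rcases hy with rfl | rfl
      · exact absurd rfl hxy
      · exact h2
      · rwa [mul_comm]
      · exact absurd rfl hxy

theorem isDTuple_triple {n : ℤ} {a b c : ℕ} (hab : a < b) (hbc : b < c) :
    IsDTuple n 3 {a, b, c} ↔
    0 < a ∧ IsSquare ((a : ℤ) * (b : ℤ) + n) ∧ IsSquare ((a : ℤ) * (c : ℤ) + n) ∧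
      IsSquare ((b : ℤ) * (c : ℤ) + n) := by
  constructor
  · rintro ⟨-, h1, h2⟩
    exact ⟨h1 a (by simp), h2 a (by simp) b (by simp) hab.ne,
      h2 a (by simp) c (by simp) (hab.trans hbc).ne, h2 b (by simp) c (by simp) hbc.ne⟩
  · rintro ⟨h1, h2, h3, h4⟩
    refine ⟨card_eq_three.2 ⟨a, b, c, hab.ne, (hab.trans hbc).ne, hbc.ne, rfl⟩, ?_, ?_⟩
    · intro x hx
      simp only [mem_insert, mem_singleton] at hx
      omega
    · intro x hx y hy hxy
      simp only [mem_insert, mem_singleton] at hx hy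
      rcases hx with rfl | rfl | rfl <;> rcases hy with rfl | rfl | rfl
      · exact absurd rfl hxy
      · exact h2
      · exact h3
      · rwa [mul_comm]
      · exact absurd rfl hxy
      · exact h4
      · rwa [mul_comm]
      · rwa [mul_comm]
      · exact absurd rfl hxy

/-- The other two square conditions are automatic: `c = a + b + 2r` makes `a + r` and `b + r` the
roots. -/
theorem isRegularTriple_triple {n : ℤ} {a b c : ℕ} (hab : a < b) (hbc : b < c) :
    IsRegularTriple n {a, b, c} ↔ 0 < a ∧ ∃ r : ℤ, 0 ≤ r ∧ r ^ 2 = (a : ℤ) * (b : ℤ) + n ∧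
      (c : ℤ) = (a : ℤ) + (b : ℤ) + 2 * r := by
  constructor
  · rintro ⟨h, a', b', c', r, h1, h2, h3, h4⟩
    obtain ⟨rfl, rfl, rfl⟩ := triple_eq_of_lt hab hbc h1 h2 h3
    exact ⟨((isDTuple_triple hab hbc).1 h).1, r, h4⟩
  · rintro ⟨h, r, h1, h2, h3⟩
    refine ⟨(isDTuple_triple hab hbc).2 ⟨h, ⟨r, by rw [← h2]; ring⟩, ⟨a + r, ?_⟩, ⟨b + r, ?_⟩⟩,
      a, b, c, r, hab, hbc, rfl, h1, h2, h3⟩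
    · rw [h3]; linear_combination -h2
    · rw [h3]; linear_combination -h2

theorem subset_Icc_triple {a b c N : ℕ} (ha : 0 < a) (hab : a < b) (hbc : b < c) :
    ({a, b, c} : Finset ℕ) ⊆ Icc 1 N ↔ c ≤ N := by
  simp only [insert_subset_iff, singleton_subset_iff, mem_Icc]
  omega

theorem subset_Icc_pair {a b N : ℕ} (ha : 0 < a) (hab : a < b) :
    ({a, b} : Finset ℕ) ⊆ Icc 1 N ↔ b ≤ N := by
  simp only [insert_subset_iff, singleton_subset_iff, mem_Icc]
  omega

open Classical in
theorem card_pairSet (n : ℤ) (N : ℕ) : (pairSet n N).card = tupleCount 2 n N := by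
  refine card_bij (fun p _ => {p.1, p.2}) ?_ ?_ ?_
  · rintro ⟨a, b⟩ h
    obtain ⟨h1, h2, h3, h4⟩ := mem_pairSet.1 h
    rw [mem_filter, mem_powerset]
    exact ⟨(subset_Icc_pair h1 h2).2 h3, (isDTuple_pair h2).2 ⟨h1, h4⟩⟩
  · rintro ⟨a, b⟩ h ⟨a', b'⟩ h' heq
    obtain ⟨rfl, rfl⟩ := pair_eq_of_lt (mem_pairSet.1 h).2.1 (mem_pairSet.1 h').2.1 heq
    rfl
  · intro S hS
    rw [mem_filter, mem_powerset] at hS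
    obtain ⟨a, b, hab, rfl⟩ := exists_lt_of_card_eq_two hS.2.1
    obtain ⟨h1, h2⟩ := (isDTuple_pair hab).1 hS.2
    exact ⟨(a, b), mem_pairSet.2 ⟨h1, hab, (subset_Icc_pair h1 hab).1 hS.1, h2⟩, rfl⟩

open Classical in
theorem card_regSet (n : ℤ) (N : ℕ) : (regSet n N).card = regularTripleCount n N := by
  refine card_bij (fun p _ => {p.1, p.2.1, p.2.2}) ?_ ?_ ?_
  · rintro ⟨a, b, c⟩ h
    obtain ⟨h1, h2, h3, h4, h5⟩ := mem_regSet.1 h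
    rw [mem_filter, mem_powerset]
    exact ⟨(subset_Icc_triple h1 h2 h3).2 h4, (isRegularTriple_triple h2 h3).2 ⟨h1, h5⟩⟩
  · rintro ⟨a, b, c⟩ h ⟨a', b', c'⟩ h' heq
    have H := mem_regSet.1 h
    have H' := mem_regSet.1 h'
    obtain ⟨rfl, rfl, rfl⟩ := triple_eq_of_lt H.2.1 H.2.2.1 H'.2.1 H'.2.2.1 heq
    rfl
  · intro S hS
    rw [mem_filter, mem_powerset] at hS
    obtain ⟨a, b, c, hab, hbc, rfl⟩ := exists_lt_of_card_eq_three hS.2.1.1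
    obtain ⟨h1, h2⟩ := (isRegularTriple_triple hab hbc).1 hS.2
    exact ⟨(a, b, c), mem_regSet.2 ⟨h1, hab, hbc, (subset_Icc_triple h1 hab hbc).1 hS.1, h2⟩, rfl⟩

open Classical in
theorem card_irrSet (n : ℤ) (N : ℕ) : (irrSet n N).card = irregularTripleCount n N := by
  refine card_bij (fun p _ => {p.1, p.2.1, p.2.2}) ?_ ?_ ?_
  · rintro ⟨a, b, c⟩ h
    obtain ⟨h1, h2, h3, h4, h5, h6, h7, h8⟩ := mem_irrSet.1 h
    rw [mem_filter, mem_powerset]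
    exact ⟨(subset_Icc_triple h1 h2 h3).2 h4, (isDTuple_triple h2 h3).2 ⟨h1, h5, h6, h7⟩,
      fun h => h8 ((isRegularTriple_triple h2 h3).1 h).2⟩
  · rintro ⟨a, b, c⟩ h ⟨a', b', c'⟩ h' heq
    have H := mem_irrSet.1 h
    have H' := mem_irrSet.1 h'
    obtain ⟨rfl, rfl, rfl⟩ := triple_eq_of_lt H.2.1 H.2.2.1 H'.2.1 H'.2.2.1 heq
    rfl
  · intro S hS
    rw [mem_filter, mem_powerset] at hS
    obtain ⟨a, b, c, hab, hbc, rfl⟩ := exists_lt_of_card_eq_three hS.2.1.1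
    obtain ⟨h1, h2, h3, h4⟩ := (isDTuple_triple hab hbc).1 hS.2.1
    exact ⟨(a, b, c), mem_irrSet.2 ⟨h1, hab, hbc, (subset_Icc_triple h1 hab hbc).1 hS.1, h2, h3, h4,
      fun h => hS.2.2 ((isRegularTriple_triple hab hbc).2 ⟨h1, h⟩)⟩, rfl⟩

open Classical in
theorem tupleCount_three_eq (n : ℤ) (N : ℕ) :
    tupleCount 3 n N = regularTripleCount n N + irregularTripleCount n N := by
  unfold tupleCount regularTripleCount irregularTripleCount
  rw [← card_union_of_disjoint]
  · congr 1
    ext S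
    rw [mem_union, mem_filter, mem_filter, mem_filter, IsIrregularTriple]
    have : IsRegularTriple n S → IsDTuple n 3 S := fun h => h.1
    tauto
  · rw [disjoint_left]
    intro S hS hS'
    exact (mem_filter.1 hS').2.2 (mem_filter.1 hS).2

/-! ### Regular triples against pairs -/

/-- A regular triple `{a, b, c}` yields the two pairs `{a, c}` and `{b, c}`. -/
theorem two_mul_card_regSet_le (n : ℤ) (N : ℕ) : 2 * (regSet n N).card ≤ (pairSet n N).card := by
  classical
  -- A pair `(x, c)` determines `r`, since `x + r` is the nonnegative root of `xc + n`; hence it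
  -- determines the third element. This gives injectivity of both maps and disjointness of their
  -- images.
  have hpartner : ∀ x c y c' r r' : ℤ, 0 < x → 0 < y → 0 ≤ r → 0 ≤ r' → x = y → c = c' →
      (x + r) ^ 2 = x * c + n → (y + r') ^ 2 = y * c' + n → r = r' := by
    rintro x c y c' r r' hx hy hr hr' rfl rfl h1 h2
    have := (sq_eq_sq₀ (by positivity) (by positivity)).1 (h1.trans h2.symm)
    linarith
  have hA : ∀ p ∈ regSet n N, ∃ r : ℤ, 0 ≤ r ∧ 0 < p.1 ∧ p.1 < p.2.1 ∧ p.2.1 < p.2.2 ∧ p.2.2 ≤ N ∧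
      (p.2.2 : ℤ) = (p.1 : ℤ) + (p.2.1 : ℤ) + 2 * r ∧
      ((p.1 : ℤ) + r) ^ 2 = p.1 * p.2.2 + n ∧ ((p.2.1 : ℤ) + r) ^ 2 = p.2.1 * p.2.2 + n := by
    rintro ⟨a, b, c⟩ h
    obtain ⟨h1, h2, h3, h4, r, h5, h6, h7⟩ := mem_regSet.1 h
    refine ⟨r, h5, h1, h2, h3, h4, h7, ?_, ?_⟩
    · simp only [h7]; linear_combination h6
    · simp only [h7]; linear_combination h6
  have h1 : ((regSet n N).image (fun p => (p.1, p.2.2))).card = (regSet n N).card := by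
    refine card_image_of_injOn ?_
    rintro ⟨a, b, c⟩ h ⟨a', b', c'⟩ h' heq
    obtain ⟨r, hr, h1, h2, h3, h4, h5, h6, h7⟩ := hA _ h
    obtain ⟨r', hr', h1', h2', h3', h4', h5', h6', h7'⟩ := hA _ h'
    simp only [Prod.mk.injEq] at *
    have := hpartner a c a' c' r r' (by omega) (by omega) hr hr' (by omega) (by omega) h6 h6'
    omega
  have h2 : ((regSet n N).image (fun p => (p.2.1, p.2.2))).card = (regSet n N).card := by
    refine card_image_of_injOn ?_
    rintro ⟨a, b, c⟩ h ⟨a', b', c'⟩ h' heq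
    obtain ⟨r, hr, h1, h2, h3, h4, h5, h6, h7⟩ := hA _ h
    obtain ⟨r', hr', h1', h2', h3', h4', h5', h6', h7'⟩ := hA _ h'
    simp only [Prod.mk.injEq] at *
    have := hpartner b c b' c' r r' (by omega) (by omega) hr hr' (by omega) (by omega) h7 h7'
    omega
  have h3 : Disjoint ((regSet n N).image (fun p => (p.1, p.2.2)))
      ((regSet n N).image (fun p => (p.2.1, p.2.2))) := by
    rw [disjoint_left]
    intro z hz hz'
    obtain ⟨⟨a, b, c⟩, h, rfl⟩ := mem_image.1 hz
    obtain ⟨⟨a', b', c'⟩, h', heq⟩ := mem_image.1 hz'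
    obtain ⟨r, hr, h1, h2, h3, h4, h5, h6, h7⟩ := hA _ h
    obtain ⟨r', hr', h1', h2', h3', h4', h5', h6', h7'⟩ := hA _ h'
    simp only [Prod.mk.injEq] at *
    have := hpartner a c b' c' r r' (by omega) (by omega) hr hr' (by omega) (by omega) h6 h7'
    omega
  rw [two_mul]
  nth_rewrite 1 [← h1]
  rw [← h2, ← card_union_of_disjoint h3]
  refine card_le_card (union_subset ?_ ?_)
  · intro z hz
    obtain ⟨⟨a, b, c⟩, h, rfl⟩ := mem_image.1 hz
    obtain ⟨r, hr, h1, h2, h3, h4, h5, h6, h7⟩ := hA _ h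
    exact mem_pairSet.2 ⟨h1, h2.trans h3, h4, (a : ℤ) + r, by rw [← sq, h6]⟩
  · intro z hz
    obtain ⟨⟨a, b, c⟩, h, rfl⟩ := mem_image.1 hz
    obtain ⟨r, hr, h1, h2, h3, h4, h5, h6, h7⟩ := hA _ h
    exact mem_pairSet.2 ⟨h1.trans h2, h3, h4, (b : ℤ) + r, by rw [← sq, h7]⟩

/-- Apart from explicit exceptions, a pair `x < c` has a partner `y` making a regular triple. -/
theorem exists_partner {n x c s : ℤ} (hn : n ≠ 0) (hx : 0 < x) (hxc : x < c)
    (hc : 2 * |n| + 1 < c) (hne : (c - x) ^ 2 ≠ 4 * n) (hs : 0 ≤ s) (h : s ^ 2 = x * c + n) :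
    x ≤ s ∧ 0 < x + c - 2 * s ∧ x + c - 2 * s < c ∧ x + c - 2 * s ≠ x := by
  have hn1 := neg_abs_le n
  have hn2 := le_abs_self n
  have hxs : x ≤ s := by
    by_contra! hlt
    nlinarith
  refine ⟨hxs, ?_, by linarith, ?_⟩
  -- If `x + c ≤ 2s`, squaring gives `(c - x)² ≤ 4n`. Equality is excluded, and a strict inequality
  -- costs a further unit in `2s`, which forces `2(c + x) < 4n`.
  · by_contra! hle
    have h1 : (c - x) ^ 2 ≤ 4 * n := by nlinarith
    have h2 : (c - x) ^ 2 < 4 * n := lt_of_le_of_ne h1 hne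
    have h3 : 2 * s ≥ c + x + 1 := by
      by_contra! h4
      nlinarith
    nlinarith
  -- Here `c = 2s`, so `s` divides `n` and `c ≤ 2|n|`.
  · intro heq
    have h1 : s ∣ n := ⟨s - 2 * x, by linear_combination -h - x * heq⟩
    have h2 : s ≤ |n| := Int.le_of_dvd (abs_pos.2 hn) ((dvd_abs s n).2 h1)
    linarith

-- Every pair lies in one of the two images of the regular triples, in a bounded box, or in the
-- exceptional family `c = x + 2k`, `n = k²`, whose companion is `0`. In that family `x` determines
-- `c`.
open Classical in
theorem card_pairSet_le (n : ℤ) (hn : n ≠ 0) (N : ℕ) :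
    (pairSet n N).card ≤ 2 * (regSet n N).card + (2 * n.natAbs + 1) ^ 2 +
      if IsSquare n then N else 0 := by
  set E := (pairSet n N).filter (fun p => ((p.2 : ℤ) - p.1) ^ 2 = 4 * n) with hE
  have hsub : pairSet n N ⊆ (regSet n N).image (fun p => (p.1, p.2.2)) ∪
      (regSet n N).image (fun p => (p.2.1, p.2.2)) ∪
      (Icc 1 (2 * n.natAbs + 1) ×ˢ Icc 1 (2 * n.natAbs + 1)) ∪ E := by
    rintro ⟨x, c⟩ hp
    obtain ⟨h1, h2, h3, s0, h4⟩ := mem_pairSet.1 hp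
    simp only [mem_union]
    by_cases hc : c ≤ 2 * n.natAbs + 1
    · left; right
      simp only [mem_product, mem_Icc]
      omega
    by_cases hne : ((c : ℤ) - x) ^ 2 = 4 * n
    · right
      exact mem_filter.2 ⟨hp, hne⟩
    left; left
    have hs : |s0| ^ 2 = (x : ℤ) * c + n := by rw [sq_abs, h4, sq]
    obtain ⟨k1, k2, k3, k4⟩ := exists_partner hn (by omega) (by omega)
      (by rw [Int.abs_eq_natAbs]; omega) hne (abs_nonneg s0) hs
    obtain ⟨y, hy⟩ := Int.eq_ofNat_of_zero_le k2.le
    rw [hy] at k2 k3 k4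
    have hr : (|s0| - x) ^ 2 = (x : ℤ) * y + n := by rw [← hy]; linear_combination hs
    rcases lt_or_gt_of_ne k4 with hlt | hlt
    · right
      refine mem_image.2 ⟨(y, x, c), mem_regSet.2 ⟨by omega, by omega, h2, h3, |s0| - x, by omega,
        by rw [hr, mul_comm], by omega⟩, rfl⟩
    · left
      refine mem_image.2 ⟨(x, y, c), mem_regSet.2 ⟨by omega, by omega, by omega, h3, |s0| - x,
        by omega, hr, by omega⟩, rfl⟩
  have hEc : E.card ≤ if IsSquare n then N else 0 := by
    split_ifs with hsq
    · have : E.card ≤ (Icc 1 N).card := by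
        refine card_le_card_of_injOn Prod.fst ?_ ?_
        · rintro ⟨x, c⟩ hp
          obtain ⟨h1, h2, h3, -⟩ := mem_pairSet.1 (mem_filter.1 hp).1
          simp only [coe_Icc, Set.mem_Icc]
          omega
        · rintro ⟨x, c⟩ hp ⟨x', c'⟩ hp' heq
          have hp := mem_filter.1 hp
          have hp' := mem_filter.1 hp'
          have h2 := (mem_pairSet.1 hp.1).2.1
          have h2' := (mem_pairSet.1 hp'.1).2.1
          simp only at heq
          subst heq
          have h0 : (0 : ℤ) ≤ c - x := by omega
          have h0' : (0 : ℤ) ≤ c' - x := by omega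
          have := (sq_eq_sq₀ h0 h0').1 (hp.2.trans hp'.2.symm)
          rw [Prod.mk.injEq]
          omega
      simpa using this
    · rw [Nat.le_zero, card_eq_zero, eq_empty_iff_forall_notMem]
      rintro ⟨x, c⟩ hp
      refine hsq ?_
      have h : ((c : ℤ) - x) ^ 2 = 4 * n := (mem_filter.1 hp).2
      have he : Even ((c : ℤ) - x) := by
        rw [← Int.even_pow' two_ne_zero, h]
        exact ⟨2 * n, by ring⟩
      obtain ⟨k, hk⟩ := he
      exact ⟨k, by rw [hk] at h; linarith⟩
  refine (card_le_card hsub).trans ?_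
  refine (card_union_le _ _).trans (Nat.add_le_add ?_ hEc)
  refine (card_union_le _ _).trans (Nat.add_le_add ?_ ?_)
  · refine (card_union_le _ _).trans ?_
    rw [two_mul]
    exact Nat.add_le_add card_image_le card_image_le
  · simp [sq]

/-! ### Divisors and square roots modulo `m` -/

/-- The divisor bound. -/
theorem card_divisors_le_rpow {ε : ℝ} (hε : 0 < ε) :
    ∃ C : ℝ, 1 ≤ C ∧ ∀ m : ℕ, (m.divisors.card : ℝ) ≤ C * (m : ℝ) ^ ε := by
  obtain ⟨A, hA1, hA⟩ : ∃ A : ℝ, 1 ≤ A ∧ ∀ k : ℕ, (k : ℝ) + 1 ≤ A * (2 : ℝ) ^ (ε * k) := by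
    have hl : 0 < ε * Real.log 2 := mul_pos hε (Real.log_pos one_lt_two)
    refine ⟨1 + 1 / (ε * Real.log 2), by simp; positivity, fun k => ?_⟩
    have h1 : ε * Real.log 2 * k + 1 ≤ (2 : ℝ) ^ (ε * k) := by
      rw [Real.rpow_def_of_pos two_pos]
      refine le_trans (le_of_eq (by ring)) (Real.add_one_le_exp _)
    have h2 : (k : ℝ) = 1 / (ε * Real.log 2) * (ε * Real.log 2 * k) := by field_simp
    have h3 : (1 : ℝ) ≤ (2 : ℝ) ^ (ε * k) := by nlinarith [mul_nonneg hl.le (Nat.cast_nonneg (α := ℝ) k)]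
    rw [add_mul, one_mul]
    have h4 : 1 / (ε * Real.log 2) * (ε * Real.log 2 * k) ≤ 1 / (ε * Real.log 2) * (2 : ℝ) ^ (ε * k) := by
      gcongr; linarith
    linarith
  -- Primes `p ≥ B` satisfy `p^ε ≥ 2`, so they cost no constant; each of the fewer than `B` smaller
  -- primes costs a factor `A`.
  obtain ⟨B, hB⟩ := exists_nat_ge ((2 : ℝ) ^ (1 / ε))
  have hlarge : ∀ p k : ℕ, B ≤ p → (k : ℝ) + 1 ≤ ((p : ℝ) ^ k) ^ ε := by
    intro p k hp
    have hp' : (2 : ℝ) ≤ (p : ℝ) ^ ε := by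
      have h : (2 : ℝ) ^ (1 / ε) ≤ p := hB.trans (by exact_mod_cast hp)
      calc (2 : ℝ) = ((2 : ℝ) ^ (1 / ε)) ^ ε := by
            rw [← Real.rpow_mul two_pos.le, one_div, inv_mul_cancel₀ hε.ne', Real.rpow_one]
        _ ≤ _ := by gcongr
    calc (k : ℝ) + 1 ≤ 2 ^ k := by exact_mod_cast Nat.lt_two_pow_self
      _ ≤ ((p : ℝ) ^ ε) ^ k := by gcongr
      _ = _ := by
        rw [← Real.rpow_natCast, ← Real.rpow_natCast, ← Real.rpow_mul (by positivity),
          ← Real.rpow_mul (by positivity), mul_comm]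
  have hsmall : ∀ p k : ℕ, p.Prime → (k : ℝ) + 1 ≤ A * ((p : ℝ) ^ k) ^ ε := by
    intro p k hp
    refine (hA k).trans ?_
    gcongr
    rw [← Real.rpow_natCast, ← Real.rpow_mul (by positivity), mul_comm]
    exact Real.rpow_le_rpow (by norm_num) (by exact_mod_cast hp.two_le) (by positivity)
  refine ⟨A ^ B, one_le_pow₀ hA1, fun m => ?_⟩
  rcases eq_or_ne m 0 with rfl | hm
  · simp; positivity
  have hfac : (m : ℝ) ^ ε = ∏ p ∈ m.primeFactors, ((p : ℝ) ^ (m.factorization p)) ^ ε := by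
    conv_lhs => rw [← Nat.prod_factorization_pow_eq_self hm]
    rw [Finsupp.prod, Nat.cast_prod, Real.finsetProd_rpow _ _ (fun _ _ => by positivity)]
    simp
  rw [Nat.card_divisors hm, hfac, Nat.cast_prod]
  calc ∏ p ∈ m.primeFactors, ((m.factorization p + 1 : ℕ) : ℝ)
      ≤ ∏ p ∈ m.primeFactors, ((if p < B then A else 1) * ((p : ℝ) ^ (m.factorization p)) ^ ε) := by
        refine prod_le_prod (fun _ _ => by positivity) fun p hp => ?_
        push_cast
        split_ifs with h
        · exact hsmall p _ (Nat.prime_of_mem_primeFactors hp)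
        · rw [one_mul]; exact hlarge p _ (not_lt.1 h)
    _ ≤ _ := by
        rw [prod_mul_distrib]
        refine mul_le_mul_of_nonneg_right ?_ (prod_nonneg fun _ _ => by positivity)
        rw [← prod_filter, prod_const]
        refine pow_le_pow_right₀ hA1 ?_
        refine (card_le_card (t := range B) fun p hp => ?_).trans (card_range B).le
        exact mem_range.2 (mem_filter.1 hp).2

/-- An interval `[0, R]` has at most `R / l + 1` elements that are pairwise congruent mod `l`. -/
theorem card_le_of_pairwise_modEq {l R : ℕ} {S : Finset ℕ}
    (hS : ∀ x ∈ S, x ≤ R) (h : ∀ x ∈ S, ∀ y ∈ S, (l : ℤ) ∣ x - y) : S.card ≤ R / l + 1 := by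
  rw [← card_range (R / l + 1)]
  refine card_le_card_of_injOn (fun x => x / l) ?_ ?_
  · intro x hx
    simp only [coe_range, Set.mem_Iio]
    exact Nat.lt_succ_of_le (Nat.div_le_div_right (hS x hx))
  · intro x hx y hy hxy
    have h1 : x ≡ y [MOD l] := ((Nat.modEq_iff_dvd).2 (h y hy x hx))
    have h2 := Nat.div_add_mod x l
    have h3 := Nat.div_add_mod y l
    simp only at hxy
    rw [← h2, ← h3, hxy, h1]

/-- The number of square roots of `k` modulo `m` in `[0, R]`. -/
theorem card_sqrt_mod_le {k : ℤ} (hk : k ≠ 0) {m : ℕ} (hm : 0 < m) {R : ℕ} {S : Finset ℕ}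
    (hS : ∀ x ∈ S, x ≤ R ∧ (m : ℤ) ∣ (x : ℤ) ^ 2 - k) :
    (S.card : ℝ) ≤ m.divisors.card * (4 * k.natAbs * R / m + 1) := by
  classical
  rcases S.eq_empty_or_nonempty with rfl | ⟨x₀, hx₀⟩
  · simp; positivity
  -- Fix one root `x₀`. Since `m ∣ (x - x₀)(x + x₀)`, a splitting of `m` puts `d` into the first
  -- factor and `m / d` into the second; each `d` then fixes `x` modulo the lcm.
  have hcover : S ⊆ m.divisors.biUnion (fun d => S.filter (fun x : ℕ =>
      (d : ℤ) ∣ (x : ℤ) - x₀ ∧ ((m / d : ℕ) : ℤ) ∣ (x : ℤ) + x₀)) := by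
    intro x hx
    have h1 : (m : ℤ) ∣ ((x : ℤ) - x₀) * (x + x₀) := by
      exact (dvd_sub (hS x hx).2 (hS x₀ hx₀).2).trans (dvd_of_eq (by ring))
    obtain ⟨d₁, d₂, h2, h3, h4⟩ := exists_dvd_and_dvd_of_dvd_mul h1
    have h5 : m = d₁.natAbs * d₂.natAbs := by
      rw [← Int.natAbs_mul, ← h4, Int.natAbs_natCast]
    have h6 : 0 < d₁.natAbs := Nat.pos_of_ne_zero fun h => by simp [h] at h5; omega
    refine mem_biUnion.2 ⟨d₁.natAbs, Nat.mem_divisors.2 ⟨⟨_, h5⟩, hm.ne'⟩,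
      mem_filter.2 ⟨hx, Int.natAbs_dvd.2 h2, ?_⟩⟩
    rw [h5, Nat.mul_div_cancel_left _ h6]
    exact Int.natAbs_dvd.2 h3
  have hclass : ∀ d ∈ m.divisors, ((S.filter (fun x : ℕ =>
      (d : ℤ) ∣ (x : ℤ) - x₀ ∧ ((m / d : ℕ) : ℤ) ∣ (x : ℤ) + x₀)).card : ℝ) ≤
      4 * k.natAbs * R / m + 1 := by
    intro d hd
    obtain ⟨hdm, -⟩ := Nat.mem_divisors.1 hd
    set T := S.filter (fun x : ℕ =>
      (d : ℤ) ∣ (x : ℤ) - x₀ ∧ ((m / d : ℕ) : ℤ) ∣ (x : ℤ) + x₀) with hT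
    rcases T.eq_empty_or_nonempty with h0 | ⟨x₁, hx₁⟩
    · rw [h0]; simp; positivity
    have hd0 : 0 < d := Nat.pos_of_dvd_of_pos hdm hm
    have he0 : 0 < m / d := Nat.div_pos (Nat.le_of_dvd hm hdm) hd0
    set l := Nat.lcm d (m / d) with hl
    have hl0 : 0 < l := Nat.lcm_pos hd0 he0
    have hcard := card_le_of_pairwise_modEq (S := T) (R := R)
      (fun x hx => (hS x (mem_filter.1 hx).1).1) (fun x hx y hy => by
        obtain ⟨-, h1, h2⟩ := mem_filter.1 hx
        obtain ⟨-, h3, h4⟩ := mem_filter.1 hy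
        have h5 : (d : ℤ) ∣ (x : ℤ) - y := 
          (dvd_sub h1 h3).trans (dvd_of_eq (by ring))
        have h6 : ((m / d : ℕ) : ℤ) ∣ (x : ℤ) - y := 
          (dvd_sub h2 h4).trans (dvd_of_eq (by ring))
        rw [Int.natCast_dvd] at h5 h6 ⊢
        exact Nat.lcm_dvd h5 h6)
    -- The gcd divides `(x₁ + x₀) - (x₁ - x₀) = 2x₀` and `x₀² - k`, hence `4x₀² - 4(x₀² - k)`. So
    -- the lcm is at least `m / (4|k|)`.
    have hg : (Nat.gcd d (m / d) : ℤ) ∣ 4 * k := by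
      obtain ⟨-, h1, h2⟩ := mem_filter.1 hx₁
      have g1 : (Nat.gcd d (m / d) : ℤ) ∣ d := by exact_mod_cast Nat.gcd_dvd_left _ _
      have g2 : (Nat.gcd d (m / d) : ℤ) ∣ ((m / d : ℕ) : ℤ) := by
        exact_mod_cast Nat.gcd_dvd_right _ _
      have g3 : (d : ℤ) ∣ m := by exact_mod_cast hdm
      have e1 := dvd_sub (g2.trans h2) (g1.trans h1)
      have e2 := ((g1.trans g3).trans (hS x₀ hx₀).2).mul_left 4
      have e3 := dvd_sub (e1.mul_left (2 * x₀)) e2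
      exact e3.trans (dvd_of_eq (by ring))
    have hml : m ≤ 4 * k.natAbs * l := by
      have h1 : Nat.gcd d (m / d) ≤ 4 * k.natAbs := by
        have := Int.natCast_dvd.1 hg
        rw [Int.natAbs_mul] at this
        exact Nat.le_of_dvd (by have := Int.natAbs_pos.2 hk; positivity) this
      calc m = d * (m / d) := (Nat.mul_div_cancel' hdm).symm
        _ = Nat.gcd d (m / d) * l := (Nat.gcd_mul_lcm _ _).symm
        _ ≤ _ := Nat.mul_le_mul_right _ h1
    calc (T.card : ℝ) ≤ ((R / l + 1 : ℕ) : ℝ) := by exact_mod_cast hcard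
      _ ≤ (R : ℝ) / l + 1 := by push_cast; gcongr; exact Nat.cast_div_le
      _ ≤ _ := by
        refine add_le_add_left ?_ 1
        rw [div_le_div_iff₀ (by exact_mod_cast hl0) (by exact_mod_cast hm)]
        have : (m : ℝ) ≤ 4 * k.natAbs * l := by exact_mod_cast hml
        nlinarith [mul_le_mul_of_nonneg_left this (Nat.cast_nonneg (α := ℝ) R)]
  calc (S.card : ℝ) ≤ ((∑ d ∈ m.divisors, (S.filter (fun x : ℕ =>
      (d : ℤ) ∣ (x : ℤ) - x₀ ∧ ((m / d : ℕ) : ℤ) ∣ (x : ℤ) + x₀)).card : ℕ) : ℝ) := by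
        exact_mod_cast (card_le_card hcover).trans card_biUnion_le
    _ ≤ ∑ d ∈ m.divisors, (4 * k.natAbs * R / m + 1 : ℝ) := by
        push_cast
        exact sum_le_sum hclass
    _ = _ := by rw [sum_const, nsmul_eq_mul]

/-! ### Counting the triples `(a, b, e)` -/

open Classical in
/-- Pairs `(a, b)` with `ab ≤ M` and `ab + n` a square. -/
noncomputable def prodPairs (n : ℤ) (M : ℕ) : Finset (ℕ × ℕ) :=
  (Icc 1 M ×ˢ Icc 1 M).filter (fun p => p.1 * p.2 ≤ M ∧ IsSquare ((p.1 : ℤ) * p.2 + n))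

open Classical in
/-- The `e` with `abe ≤ M` and `be + n²` a square. -/
noncomputable def extensions (n : ℤ) (M a b : ℕ) : Finset ℕ :=
  (Icc 1 M).filter (fun e => a * b * e ≤ M ∧ IsSquare ((b : ℤ) * e + n ^ 2))

theorem sqrt_div_le {M a b K : ℕ} (ha : 0 < a) (hb : 0 < b) :
    ((Nat.sqrt (M / a + K ^ 2) : ℕ) : ℝ) / b ≤ √M / √((a * b : ℕ) : ℝ) + K := by
  have hb1 : (1 : ℝ) ≤ b := by exact_mod_cast hb
  have ha0 : (0 : ℝ) < a := by exact_mod_cast ha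
  have h1 : ((Nat.sqrt (M / a + K ^ 2) : ℕ) : ℝ) ≤ √M / √a + K := by
    calc ((Nat.sqrt (M / a + K ^ 2) : ℕ) : ℝ) ≤ √((M / a + K ^ 2 : ℕ) : ℝ) :=
          Real.nat_sqrt_le_real_sqrt
      _ ≤ √((M : ℝ) / a + (K : ℝ) ^ 2) := by
          push_cast
          gcongr
          exact Nat.cast_div_le
      _ ≤ √((M : ℝ) / a) + K := by
          have h := Real.sq_sqrt (by positivity : (0 : ℝ) ≤ (M : ℝ) / a)
          refine Real.sqrt_le_iff.2 ⟨by positivity, ?_⟩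
          nlinarith [mul_nonneg (Real.sqrt_nonneg ((M : ℝ) / a)) (Nat.cast_nonneg (α := ℝ) K)]
      _ = _ := by rw [Real.sqrt_div (by positivity)]
  have h2 : √(b : ℝ) ≤ b := Real.sqrt_le_iff.2 ⟨by positivity, by nlinarith⟩
  have h3 : 0 < √(b : ℝ) := Real.sqrt_pos.2 (by positivity)
  have h4 : 0 < √(a : ℝ) := Real.sqrt_pos.2 (by positivity)
  calc _ ≤ (√M / √a + K) / b := by gcongr
    _ = √M / √a / b + K / b := by ring
    _ ≤ √M / √a / √b + K / 1 := by gcongr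
    _ = _ := by
      push_cast
      rw [Real.sqrt_mul ha0.le, div_div, div_one]

/-- Each `e` corresponds to a root `y` of `y² ≡ n²` modulo `b` with `y² ≤ M / a + n²`, so the bound
for square roots modulo `b` applies. -/
theorem card_extensions_le {n : ℤ} (hn : n ≠ 0) {M a b : ℕ} (ha : 0 < a) (hb : 0 < b) :
    ((extensions n M a b).card : ℝ) ≤ b.divisors.card *
      (4 * n.natAbs ^ 2 * (√M / √((a * b : ℕ) : ℝ) + n.natAbs) + 1) := by
  classical
  set K := n.natAbs with hK
  have hn2 : n ^ 2 = ((K ^ 2 : ℕ) : ℤ) := by push_cast; rw [hK, Int.natCast_natAbs, sq_abs]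
  set S := (extensions n M a b).image (fun e => Nat.sqrt (b * e + K ^ 2)) with hSdef
  have hroot : ∀ e ∈ extensions n M a b, Nat.sqrt (b * e + K ^ 2) ^ 2 = b * e + K ^ 2 := by
    intro e he
    obtain ⟨-, -, h⟩ := mem_filter.1 he
    rw [hn2] at h
    have h' : IsSquare (b * e + K ^ 2) := by exact_mod_cast h
    obtain ⟨r, hr⟩ := h'
    rw [hr, Nat.sqrt_eq, sq]
  have hcard : S.card = (extensions n M a b).card := by
    refine card_image_of_injOn fun e he e' he' heq => ?_
    have h1 := hroot e he
    have h2 := hroot e' he'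
    rw [heq, h2] at h1
    exact (Nat.eq_of_mul_eq_mul_left hb (by omega : b * e' = b * e)).symm
  have h := card_sqrt_mod_le (k := n ^ 2) (pow_ne_zero 2 hn) hb (R := Nat.sqrt (M / a + K ^ 2))
    (S := S) (by
      intro x hx
      obtain ⟨e, he, rfl⟩ := mem_image.1 hx
      constructor
      · refine Nat.sqrt_le_sqrt (Nat.add_le_add_right ?_ _)
        rw [Nat.le_div_iff_mul_le ha]
        have := (mem_filter.1 he).2.1
        linarith [mul_comm a (b * e), mul_assoc a b e]
      · refine ⟨e, ?_⟩
        have := hroot e he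
        rw [hn2]
        have h2 : ((Nat.sqrt (b * e + K ^ 2) : ℤ)) ^ 2 = b * e + ((K ^ 2 : ℕ) : ℤ) := by
          exact_mod_cast this
        rw [h2]; ring)
  rw [hcard] at h
  refine h.trans ?_
  rw [Int.natAbs_pow, ← hK, mul_div_assoc]
  push_cast
  gcongr
  exact_mod_cast sqrt_div_le ha hb

/-- The root attached to a pair. -/
noncomputable def pairRoot (n : ℤ) (p : ℕ × ℕ) : ℕ := Nat.sqrt ((p.1 : ℤ) * p.2 + n).toNat

theorem pairRoot_sq {n : ℤ} {a b : ℕ} (h : IsSquare ((a : ℤ) * b + n)) :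
    ((pairRoot n (a, b) : ℕ) : ℤ) ^ 2 = (a : ℤ) * b + n := by
  obtain ⟨r, hr⟩ := h
  have h1 : (r * r).toNat = r.natAbs * r.natAbs := by
    rw [← Int.natAbs_mul_self' r]
    exact Int.toNat_natCast _
  rw [pairRoot, hr]
  rw [h1, Nat.sqrt_eq, Int.natCast_natAbs, sq_abs, sq]

/-- Replaces `1 / √(ab)` by a harmonic term in the root, so that pairs can be grouped by root. The
shift `+ 1` allows the root `0`. -/
theorem inv_sqrt_le {n : ℤ} {a b : ℕ} (ha : 0 < a) (hb : 0 < b)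
    (h : IsSquare ((a : ℤ) * b + n)) :
    1 / √((a * b : ℕ) : ℝ) ≤ 2 * (n.natAbs + 1) / (pairRoot n (a, b) + 1) := by
  set r := pairRoot n (a, b)
  set K := n.natAbs with hK
  have h1 : (r : ℤ) ^ 2 = (a : ℤ) * b + n := pairRoot_sq h
  have h2 : ((r : ℝ) + 1) ^ 2 ≤ (2 * (K + 1)) ^ 2 * ((a * b : ℕ) : ℝ) := by
    have hab : 1 ≤ a * b := Nat.mul_pos ha hb
    have h3 : r ^ 2 ≤ a * b + K := by zify; have : n ≤ K := by omega
                                      linarith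
    have h4 : (r + 1) ^ 2 ≤ (2 * (K + 1)) ^ 2 * (a * b) := by
      have h5 : 2 * r ≤ r ^ 2 + 1 := by zify; nlinarith [sq_nonneg ((r : ℤ) - 1)]
      nlinarith [Nat.mul_le_mul_left K hab,
        Nat.mul_le_mul_left (K * K) hab]
    exact_mod_cast h4
  have hpos : 0 < √((a * b : ℕ) : ℝ) := Real.sqrt_pos.2 (by exact_mod_cast Nat.mul_pos ha hb)
  rw [div_le_div_iff₀ hpos (by positivity), one_mul]
  have h5 := Real.sqrt_le_sqrt h2
  rwa [Real.sqrt_sq (by positivity), Real.sqrt_mul (by positivity),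
    Real.sqrt_sq (by positivity)] at h5

/-- For a fixed root the product `ab = r² - n` is fixed, so `a` is one of its divisors and
determines `b`. -/
theorem card_prodPairs_filter_le {n : ℤ} {M r : ℕ} {B : ℝ} (hB : 0 ≤ B)
    (hdiv : ∀ m : ℕ, m ≤ M → (m.divisors.card : ℝ) ≤ B) :
    (((prodPairs n M).filter (fun p => pairRoot n p = r)).card : ℝ) ≤ B := by
  rcases ((prodPairs n M).filter (fun p => pairRoot n p = r)).eq_empty_or_nonempty with h | ⟨p, hp⟩
  · simpa [h] using hB
  have key : ∀ p ∈ (prodPairs n M).filter (fun p => pairRoot n p = r),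
      p.1 * p.2 = ((r : ℤ) ^ 2 - n).toNat ∧ 0 < p.1 ∧ 0 < p.2 ∧ p.1 * p.2 ≤ M := by
    rintro ⟨a, b⟩ hp
    obtain ⟨h1, h2⟩ := mem_filter.1 hp
    obtain ⟨h3, h4, h5⟩ := mem_filter.1 h1
    have h6 := pairRoot_sq h5
    rw [mem_product, mem_Icc, mem_Icc] at h3
    refine ⟨?_, by omega, by omega, h4⟩
    rw [← h2, h6, add_sub_cancel_right]
    exact (Int.toNat_natCast (a * b)).symm
  refine le_trans ?_ (hdiv _ ((key p hp).1 ▸ (key p hp).2.2.2))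
  rw [Nat.cast_le]
  refine card_le_card_of_injOn Prod.fst ?_ ?_
  · intro q hq
    obtain ⟨h1, h2, h3, -⟩ := key q hq
    rw [mem_coe, Nat.mem_divisors, ← h1]
    exact ⟨dvd_mul_right _ _, (Nat.mul_pos h2 h3).ne'⟩
  · intro q hq q' hq' heq
    obtain ⟨h1, h2, -⟩ := key q hq
    obtain ⟨h1', -⟩ := key q' hq'
    rw [← h1', ← heq] at h1
    exact Prod.ext heq (Nat.eq_of_mul_eq_mul_left h2 h1)

theorem sum_range_inv_le {ε : ℝ} (hε : 0 < ε) (R : ℕ) :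
    ∑ r ∈ range R, 1 / ((r : ℝ) + 1) ≤ 1 + (R : ℝ) ^ ε / ε := by
  have h := harmonic_le_one_add_log R
  have h1 : ((harmonic R : ℚ) : ℝ) = ∑ r ∈ range R, 1 / ((r : ℝ) + 1) := by
    rw [harmonic]; push_cast; simp [one_div]
  rw [← h1]
  linarith [Real.log_le_rpow_div (Nat.cast_nonneg (α := ℝ) R) hε]

/-- The main counting estimate: the number of `(a, b, e)` with `abe ≤ M`, `ab + n` and `be + n²`
squares is `O(M ^ (1 / 2 + 3ε))`. -/
theorem sum_card_extensions_le {n : ℤ} (hn : n ≠ 0) {ε : ℝ} (hε : 0 < ε) :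
    ∃ C : ℝ, 0 < C ∧ ∀ M : ℕ, 1 ≤ M →
      ∑ p ∈ prodPairs n M, ((extensions n M p.1 p.2).card : ℝ) ≤
        C * (M : ℝ) ^ (1 / 2 + 3 * ε) := by
  obtain ⟨D, hD1, hD⟩ := card_divisors_le_rpow hε
  set K : ℝ := (n.natAbs : ℝ) with hK
  have hK0 : 0 ≤ K := by positivity
  refine ⟨D ^ 2 * (8 * K ^ 2 * (K + 1) * (1 + (K + 2) ^ ε / ε) + (4 * K ^ 3 + 1) * (K + 2)),
    by positivity, fun M hM => ?_⟩
  have hM1 : (1 : ℝ) ≤ M := by exact_mod_cast hM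
  have hMε : (1 : ℝ) ≤ (M : ℝ) ^ ε := Real.one_le_rpow hM1 hε.le
  have hdiv : ∀ m : ℕ, m ≤ M → (m.divisors.card : ℝ) ≤ D * (M : ℝ) ^ ε := fun m hm =>
    (hD m).trans (by gcongr)
  set R := Nat.sqrt (M + n.natAbs) + 1 with hR
  -- `g r` bounds the extensions of any pair with root `r`. The three factors `M^ε` come from the
  -- divisors of `b`, the pairs per root, and the harmonic sum.
  set g : ℕ → ℝ := fun r => D * (M : ℝ) ^ ε *
    (8 * K ^ 2 * (K + 1) * √M * (1 / ((r : ℝ) + 1)) + (4 * K ^ 3 + 1)) with hg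
  have hg0 : ∀ r, 0 ≤ g r := fun r => by positivity
  have hRM : (R : ℝ) ≤ (K + 2) * √M := by
    have h1 : (1 : ℝ) ≤ √M := Real.one_le_sqrt.2 hM1
    have h2 : ((Nat.sqrt (M + n.natAbs) : ℕ) : ℝ) ≤ √((M + n.natAbs : ℕ) : ℝ) :=
      Real.nat_sqrt_le_real_sqrt
    have h3 : √((M + n.natAbs : ℕ) : ℝ) ≤ (K + 1) * √M := by
      rw [← Real.sqrt_sq (by positivity : (0 : ℝ) ≤ K + 1), ← Real.sqrt_mul (by positivity)]
      refine Real.sqrt_le_sqrt ?_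
      rw [Nat.cast_add, ← hK]
      nlinarith [mul_le_mul_of_nonneg_left hM1 hK0, mul_nonneg (sq_nonneg K) (zero_le_one.trans hM1)]
    rw [hR]
    push_cast
    linarith
  have hsqM : √(M : ℝ) ≤ M := Real.sqrt_le_iff.2 ⟨by positivity, by nlinarith⟩
  have hstep1 : ∀ p ∈ prodPairs n M,
      ((extensions n M p.1 p.2).card : ℝ) ≤ g (pairRoot n p) ∧ pairRoot n p ∈ range R := by
    rintro ⟨a, b⟩ hp
    obtain ⟨h1, h2, h3⟩ := mem_filter.1 hp
    rw [mem_product, mem_Icc, mem_Icc] at h1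
    have ha : 0 < a := by omega
    have hb : 0 < b := by omega
    constructor
    · refine (card_extensions_le hn ha hb).trans ?_
      have h4 := inv_sqrt_le ha hb h3
      refine (mul_le_mul_of_nonneg_right (hdiv b (by omega)) (by positivity)).trans ?_
      rw [hg]
      refine mul_le_mul_of_nonneg_left ?_ (by positivity)
      rw [← hK]
      calc 4 * K ^ 2 * (√M / √((a * b : ℕ) : ℝ) + K) + 1
          = 4 * K ^ 2 * √M * (1 / √((a * b : ℕ) : ℝ)) + (4 * K ^ 3 + 1) := by ring
        _ ≤ 4 * K ^ 2 * √M * (2 * (K + 1) / (pairRoot n (a, b) + 1)) + (4 * K ^ 3 + 1) := by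
            gcongr
        _ = _ := by ring
    · rw [mem_range, hR, Nat.lt_succ_iff, Nat.le_sqrt']
      have h4 := pairRoot_sq h3
      zify
      zify at h2
      rw [h4]
      have := le_abs_self n
      linarith
  calc ∑ p ∈ prodPairs n M, ((extensions n M p.1 p.2).card : ℝ)
      ≤ ∑ p ∈ prodPairs n M, g (pairRoot n p) := sum_le_sum fun p hp => (hstep1 p hp).1
    _ = ∑ r ∈ range R, ∑ p ∈ (prodPairs n M).filter (fun p => pairRoot n p = r),
          g (pairRoot n p) :=
        (sum_fiberwise_of_maps_to (fun p hp => (hstep1 p hp).2) _).symm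
    _ = ∑ r ∈ range R, (((prodPairs n M).filter (fun p => pairRoot n p = r)).card : ℝ) * g r := by
        refine sum_congr rfl fun r _ => ?_
        rw [← nsmul_eq_mul, ← sum_const]
        exact sum_congr rfl fun p hp => by rw [(mem_filter.1 hp).2]
    _ ≤ ∑ r ∈ range R, D * (M : ℝ) ^ ε * g r := by
        refine sum_le_sum fun r _ => mul_le_mul_of_nonneg_right ?_ (hg0 r)
        exact card_prodPairs_filter_le (by positivity) hdiv
    _ = (D * (M : ℝ) ^ ε) ^ 2 * (8 * K ^ 2 * (K + 1) * √M * ∑ r ∈ range R, 1 / ((r : ℝ) + 1) +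
          (4 * K ^ 3 + 1) * R) := by
        simp only [hg]
        rw [← mul_sum, ← mul_sum, sum_add_distrib, ← mul_sum, sum_const, card_range, nsmul_eq_mul]
        ring
    _ ≤ (D * (M : ℝ) ^ ε) ^ 2 * (8 * K ^ 2 * (K + 1) * √M * ((1 + (K + 2) ^ ε / ε) * (M : ℝ) ^ ε) +
          (4 * K ^ 3 + 1) * ((K + 2) * √M * (M : ℝ) ^ ε)) := by
        gcongr
        · refine (sum_range_inv_le hε R).trans ?_
          have h1 : (R : ℝ) ^ ε ≤ (K + 2) ^ ε * (M : ℝ) ^ ε := by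
            rw [← Real.mul_rpow (by positivity) (by positivity)]
            gcongr
            exact hRM.trans (by gcongr)
          calc 1 + (R : ℝ) ^ ε / ε ≤ (M : ℝ) ^ ε + (K + 2) ^ ε * (M : ℝ) ^ ε / ε := by gcongr
            _ = _ := by ring
        · exact hRM.trans (le_mul_of_one_le_right (by positivity) hMε)
    _ = _ := by
        rw [Real.rpow_add (by positivity), ← Real.sqrt_eq_rpow, mul_comm 3 ε,
          Real.rpow_mul (by positivity)]
        norm_cast
        ring

/-! ### Descent for irregular triples -/

/-- The descent element of a triple. -/
noncomputable def descent (n : ℤ) (a b c : ℕ) : ℤ :=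
  n * (a + b + c) + 2 * a * b * c -
    2 * pairRoot n (a, b) * pairRoot n (a, c) * pairRoot n (b, c)

/-- With `e` the descent element and `E` its conjugate, `eE` is at most `n²c²` while `E ≥ abc / 2`;
dividing bounds `abe`. -/
theorem descent_bounds {n a b c r s t : ℤ} (hn : n ≠ 0) (ha : 0 < a) (hab : a < b) (hbc : b < c)
    (hr0 : 0 ≤ r) (hs0 : 0 ≤ s) (ht0 : 0 ≤ t) (hr : r ^ 2 = a * b + n) (hs : s ^ 2 = a * c + n)
    (ht : t ^ 2 = b * c + n) (hirr : c ≠ a + b + 2 * r) (hc : n ^ 2 + 4 * |n| < c) :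
    1 ≤ n * (a + b + c) + 2 * a * b * c - 2 * r * s * t ∧
    a * b * (n * (a + b + c) + 2 * a * b * c - 2 * r * s * t) ≤ 2 * n ^ 2 * c ∧
    b * (n * (a + b + c) + 2 * a * b * c - 2 * r * s * t) + n ^ 2 = (b * s - r * t) ^ 2 := by
  set e := n * (a + b + c) + 2 * a * b * c - 2 * r * s * t with he
  set E := n * (a + b + c) + 2 * a * b * c + 2 * r * s * t with hE
  have hn1 := neg_abs_le n
  have hn2 := le_abs_self n
  have hnpos : 1 ≤ |n| := Int.one_le_abs hn
  have hprod : (r * s * t) ^ 2 = (a * b + n) * (a * c + n) * (b * c + n) := by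
    rw [mul_pow, mul_pow, hr, hs, ht]
  have hid : e * E = n ^ 2 * ((c - a - b) ^ 2 - 4 * r ^ 2) := by
    rw [he, hE, hr]
    linear_combination -4 * hprod
  have hy : b * e + n ^ 2 = (b * s - r * t) ^ 2 := by
    rw [he, sub_sq, mul_pow, mul_pow, hr, hs, ht]; ring
  have hz : c * e + n ^ 2 = (c * r - s * t) ^ 2 := by
    rw [he, sub_sq, mul_pow, mul_pow, hr, hs, ht]; ring
  have hE1 : a * b * c ≤ 2 * E := by
    have hrst : 0 ≤ r * s * t := by positivity
    have hbpos : 0 < b := ha.trans hab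
    have hcpos : 0 < c := hbpos.trans hbc
    have habc : 0 < a * b * c := by positivity
    rcases le_or_gt 0 n with h0 | h0
    · have : 0 ≤ n * (a + b + c) := by positivity
      rw [hE]; linarith
    · have h1 : -n ≤ a * b := by nlinarith [sq_nonneg r]
      have h2 : a + b ≤ 2 * (a * b) := by nlinarith
      have h3 : -n * c ≤ a * b * c := mul_le_mul_of_nonneg_right h1 hcpos.le
      have h4 : -n * (a + b) ≤ -n * (2 * (a * b)) := mul_le_mul_of_nonneg_left h2 (by linarith)
      have h5 : a * b * (4 * -n) ≤ a * b * c := by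
        refine mul_le_mul_of_nonneg_left ?_ (by positivity)
        rw [abs_of_neg h0] at hc
        nlinarith [sq_nonneg n]
      rw [hE]; linarith
  have hcpos : 0 < c := ha.trans (hab.trans hbc)
  -- A negative `e` would give `ce + n² ≤ n² - c < 0`, yet `ce + n²` is a square.
  have he0 : 0 ≤ e := by
    by_contra! h
    have : c * e ≤ c * (-1) := mul_le_mul_of_nonneg_left (by omega) hcpos.le
    nlinarith [sq_nonneg (c * r - s * t)]
  have hene : e ≠ 0 := by
    intro h
    rw [h, zero_mul] at hid
    have h1 : (c - a - b - 2 * r) * (c - a - b + 2 * r) = 0 := by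
      have := (mul_eq_zero.1 hid.symm).resolve_left (pow_ne_zero 2 hn)
      linear_combination this
    rcases mul_eq_zero.1 h1 with h2 | h2
    · exact hirr (by linarith)
    -- In the case `c = a + b - 2r`, `b < c` gives `2r < a`, so `4(ab + n) < a²`. Then `a` and `b`
    -- are bounded in terms of `|n|`, against the size of `c`.
    · have h3 : 2 * r + 1 ≤ a := by linarith
      have h4 : (2 * r) ^ 2 ≤ a ^ 2 := pow_le_pow_left₀ (by linarith) (by linarith) 2
      have h5 : a * (a + 1) ≤ a * b := mul_le_mul_of_nonneg_left (by omega) ha.le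
      have h6 : a ≤ |n| := by linarith [sq_nonneg a]
      have h7 : 4 * b ≤ a + 4 * |n| := by
        by_contra! h
        have h9 : a * (a + 4 * |n|) < a * (4 * b) := mul_lt_mul_of_pos_left h ha
        have h10 : 1 * |n| ≤ a * |n| := mul_le_mul_of_nonneg_right (by omega) (abs_nonneg n)
        linarith
      linarith [sq_nonneg n]
  refine ⟨by omega, ?_, hy⟩
  have h1 : e * (a * b * c) ≤ e * (2 * E) := mul_le_mul_of_nonneg_left hE1 he0
  have h2 : (c - a - b) ^ 2 - 4 * r ^ 2 ≤ c ^ 2 := by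
    have : (c - a - b) ^ 2 ≤ c ^ 2 := sq_le_sq' (by linarith) (by linarith)
    linarith [sq_nonneg r]
  have h3 : n ^ 2 * ((c - a - b) ^ 2 - 4 * r ^ 2) ≤ n ^ 2 * c ^ 2 :=
    mul_le_mul_of_nonneg_left h2 (sq_nonneg n)
  have h4 : a * b * e * c ≤ 2 * n ^ 2 * c * c := by linarith
  exact le_of_mul_le_mul_right h4 hcpos

theorem card_quadratic_roots_le {α β γ : ℤ} (hα : α ≠ 0) {S : Finset ℕ}
    (h : ∀ c ∈ S, α * (c : ℤ) ^ 2 + β * c + γ = 0) : S.card ≤ 2 := by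
  by_contra! h2
  obtain ⟨x, y, z, hx, hy, hz, hxy, hxz, hyz⟩ := two_lt_card_iff.1 h2
  have e1 : ((x : ℤ) - y) * (α * (x + y) + β) = 0 := by linear_combination h x hx - h y hy
  have e2 : ((x : ℤ) - z) * (α * (x + z) + β) = 0 := by linear_combination h x hx - h z hz
  have f1 := (mul_eq_zero.1 e1).resolve_left (sub_ne_zero.2 (by exact_mod_cast hxy))
  have f2 := (mul_eq_zero.1 e2).resolve_left (sub_ne_zero.2 (by exact_mod_cast hxz))
  have e3 : α * ((y : ℤ) - z) = 0 := by linear_combination f1 - f2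
  exact mul_ne_zero hα (sub_ne_zero.2 (by exact_mod_cast hyz)) e3

/-- Isolating `2rst` and squaring gives a quadratic in `c` with leading coefficient `(n + 2ab)² -
4ab(ab + n) = n²`, which is nonzero for `n ≠ 0`; hence at most two `c` share `(a, b, e)`. -/
theorem descent_quadratic {n : ℤ} {a b c : ℕ} (h1 : IsSquare ((a : ℤ) * b + n))
    (h2 : IsSquare ((a : ℤ) * c + n)) (h3 : IsSquare ((b : ℤ) * c + n)) :
    n ^ 2 * (c : ℤ) ^ 2 + (-2 * (n + 2 * a * b) * (descent n a b c - n * (a + b)) -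
      4 * (a * b + n) * n * (a + b)) * c +
      ((descent n a b c - n * (a + b)) ^ 2 - 4 * (a * b + n) * n ^ 2) = 0 := by
  have e1 := pairRoot_sq h1
  have e2 := pairRoot_sq h2
  have e3 := pairRoot_sq h3
  have hprod : ((pairRoot n (a, b) : ℤ) * pairRoot n (a, c) * pairRoot n (b, c)) ^ 2 =
      (a * b + n) * (a * c + n) * (b * c + n) := by
    rw [mul_pow, mul_pow, e1, e2, e3]
  unfold descent
  linear_combination 4 * hprod

theorem card_irrSet_le {n : ℤ} (hn : n ≠ 0) (N : ℕ) :
    (irrSet n N).card ≤ (n.natAbs ^ 2 + 4 * n.natAbs) ^ 3 +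
      2 * ∑ p ∈ prodPairs n (2 * n.natAbs ^ 2 * N),
        (extensions n (2 * n.natAbs ^ 2 * N) p.1 p.2).card := by
  classical
  set C := n.natAbs ^ 2 + 4 * n.natAbs with hC
  have hCn : (C : ℤ) = n ^ 2 + 4 * |n| := by rw [hC]; push_cast; simp
  set M := 2 * n.natAbs ^ 2 * N with hM
  have hMn : (M : ℤ) = 2 * n ^ 2 * N := by rw [hM]; push_cast; simp
  rw [← card_filter_add_card_filter_not (s := irrSet n N) (fun p => p.2.2 ≤ C)]
  refine Nat.add_le_add ?_ ?_
  · have : (irrSet n N).filter (fun p => p.2.2 ≤ C) ⊆ Icc 1 C ×ˢ Icc 1 C ×ˢ Icc 1 C := by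
      rintro ⟨a, b, c⟩ h
      obtain ⟨h1, h2⟩ := mem_filter.1 h
      obtain ⟨h3, h4, h5, -⟩ := mem_irrSet.1 h1
      simp only [mem_product, mem_Icc] at h2 ⊢
      omega
    refine (card_le_card this).trans (le_of_eq ?_)
    simp only [card_product, Nat.card_Icc, Nat.add_sub_cancel]
    ring
  · rw [← card_sigma]
    have hbd : ∀ a b c : ℕ, (a, b, c) ∈ (irrSet n N).filter (fun p => ¬ p.2.2 ≤ C) →
        1 ≤ descent n a b c ∧ (a : ℤ) * b * descent n a b c ≤ M ∧
        IsSquare ((b : ℤ) * descent n a b c + n ^ 2) := by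
      intro a b c h
      obtain ⟨h1, h2⟩ := mem_filter.1 h
      obtain ⟨h3, h4, h5, h6, h7, h8, h9, h10⟩ := mem_irrSet.1 h1
      have := descent_bounds (n := n) (a := a) (b := b) (c := c) hn (by omega) (by omega) (by omega)
        (Int.natCast_nonneg _) (Int.natCast_nonneg _) (Int.natCast_nonneg _) (pairRoot_sq h7)
        (pairRoot_sq h8) (pairRoot_sq h9)
        (fun h => h10 ⟨_, Int.natCast_nonneg _, pairRoot_sq h7, h⟩)
        (by rw [← hCn]; simp only at h2; omega)
      refine ⟨this.1, this.2.1.trans ?_, _, this.2.2.trans (sq _)⟩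
      rw [hMn]
      have : (c : ℤ) ≤ N := by omega
      gcongr
    refine card_le_mul_card_image_of_maps_to
      (f := fun p => (⟨(p.1, p.2.1), (descent n p.1 p.2.1 p.2.2).toNat⟩ : Σ _ : ℕ × ℕ, ℕ)) ?_ 2 ?_
    · rintro ⟨a, b, c⟩ h
      obtain ⟨k1, k2, k3⟩ := hbd a b c h
      obtain ⟨h3, h4, h5, h6, h7, h8, h9, h10⟩ := mem_irrSet.1 (mem_filter.1 h).1
      obtain ⟨e, he⟩ := Int.eq_ofNat_of_zero_le (zero_le_one.trans k1)
      simp only [he, Int.toNat_natCast] at k1 k2 k3 ⊢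
      have hb : 0 < b := by omega
      have he1 : 1 ≤ e := by omega
      have habe : a * b * e ≤ M := by exact_mod_cast k2
      have hab1 : 1 ≤ a * b := Nat.mul_pos h3 hb
      have hab : a * b ≤ M := (Nat.le_mul_of_pos_right _ he1).trans habe
      refine mem_sigma.2 ⟨mem_filter.2 ⟨?_, hab, h7⟩, mem_filter.2 ⟨?_, habe, k3⟩⟩
      · rw [mem_product, mem_Icc, mem_Icc]
        exact ⟨⟨h3, (Nat.le_mul_of_pos_right _ hb).trans hab⟩, hb,
          (Nat.le_mul_of_pos_left _ h3).trans hab⟩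
      · exact mem_Icc.2 ⟨he1, (Nat.le_mul_of_pos_left _ hab1).trans habe⟩
    · rintro ⟨⟨a, b⟩, e⟩ -
      set F := ((irrSet n N).filter (fun p => ¬ p.2.2 ≤ C)).filter (fun p =>
        (⟨(p.1, p.2.1), (descent n p.1 p.2.1 p.2.2).toNat⟩ : Σ _ : ℕ × ℕ, ℕ) = ⟨(a, b), e⟩) with hF
      have hFmem : ∀ a' b' c', (a', b', c') ∈ F → a' = a ∧ b' = b ∧ descent n a b c' = e ∧
          (a, b, c') ∈ irrSet n N := by
        intro a' b' c' h
        obtain ⟨h1, h2⟩ := mem_filter.1 h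
        simp only [Sigma.mk.injEq, Prod.mk.injEq, heq_eq_eq] at h2
        obtain ⟨⟨rfl, rfl⟩, h3⟩ := h2
        exact ⟨rfl, rfl, by have := (hbd _ _ _ h1).1; omega, (mem_filter.1 h1).1⟩
      have hcard : (F.image (fun p => p.2.2)).card = F.card := by
        refine card_image_of_injOn ?_
        rintro ⟨a₁, b₁, c₁⟩ h₁ ⟨a₂, b₂, c₂⟩ h₂ heq
        obtain ⟨rfl, rfl, -⟩ := hFmem _ _ _ h₁
        obtain ⟨rfl, rfl, -⟩ := hFmem _ _ _ h₂
        simp only at heq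
        rw [heq]
      rw [← hcard]
      refine card_quadratic_roots_le (pow_ne_zero 2 hn) (β := -2 * (n + 2 * a * b) *
        (e - n * (a + b)) - 4 * (a * b + n) * n * (a + b))
        (γ := (e - n * (a + b)) ^ 2 - 4 * (a * b + n) * n ^ 2) fun c hc => ?_
      obtain ⟨⟨a', b', c'⟩, hp, rfl⟩ := mem_image.1 hc
      obtain ⟨rfl, rfl, h1, h2⟩ := hFmem _ _ _ hp
      obtain ⟨-, -, -, -, h7, h8, h9, -⟩ := mem_irrSet.1 h2
      rw [← h1]
      exact descent_quadratic h7 h8 h9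

theorem irregularTripleCount_isBigO {n : ℤ} (hn : n ≠ 0) :
    (fun N : ℕ => (irregularTripleCount n N : ℝ)) =O[Filter.atTop]
      (fun N : ℕ => (N : ℝ) ^ (0.52 : ℝ)) := by
  -- The choice of `ε` makes `1/2 + 3ε = 0.52`.
  obtain ⟨C, hC0, hC⟩ := sum_card_extensions_le hn (ε := 1 / 150) (by norm_num)
  set C₀ : ℝ := (((n.natAbs ^ 2 + 4 * n.natAbs) ^ 3 : ℕ) : ℝ) with hC₀
  set L : ℝ := ((2 * n.natAbs ^ 2 : ℕ) : ℝ) with hL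
  refine Asymptotics.IsBigO.of_bound (C₀ + 2 * (C * L ^ (0.52 : ℝ))) ?_
  filter_upwards [Filter.eventually_ge_atTop 1] with N hN
  have hN1 : (1 : ℝ) ≤ (N : ℝ) ^ (0.52 : ℝ) :=
    Real.one_le_rpow (by exact_mod_cast hN) (by norm_num)
  rw [Real.norm_of_nonneg (by positivity), Real.norm_of_nonneg (by positivity), ← card_irrSet]
  have h1 := card_irrSet_le hn N
  have h2 := hC (2 * n.natAbs ^ 2 * N) (by
    have := Int.natAbs_pos.2 hn
    exact Nat.succ_le_of_lt (by positivity))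
  have h3 : (1 / 2 + 3 * (1 / 150) : ℝ) = 0.52 := by norm_num
  rw [h3, Nat.cast_mul, Real.mul_rpow (by positivity) (by positivity)] at h2
  have h4 : ((irrSet n N).card : ℝ) ≤ C₀ + 2 * ∑ p ∈ prodPairs n (2 * n.natAbs ^ 2 * N),
        ((extensions n (2 * n.natAbs ^ 2 * N) p.1 p.2).card : ℝ) := by
    rw [hC₀]
    exact_mod_cast h1
  have h5 : C₀ ≤ C₀ * (N : ℝ) ^ (0.52 : ℝ) := le_mul_of_one_le_right (by positivity) hN1
  linarith

/-! ### Linear lower bound for the number of pairs -/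

theorem sum_inv_sq_le (Y : ℕ) : ∑ d ∈ Ioc 1 Y, 1 / (d : ℝ) ^ 2 ≤ 3 / 4 := by
  have h : ∀ Y : ℕ, ∑ d ∈ Ioc 1 (Y + 2), 1 / (d : ℝ) ^ 2 ≤ 3 / 4 - 1 / ((Y : ℝ) + 2) := by
    intro Y
    induction Y with
    | zero =>
      have : Ioc 1 2 = {2} := rfl
      simp [this]; norm_num
    | succ Y ih =>
      rw [sum_Ioc_succ_top (by omega)]
      have h2 : 1 / ((Y + 2 + 1 : ℕ) : ℝ) ^ 2 ≤ 1 / ((Y : ℝ) + 2) - 1 / ((Y : ℝ) + 3) := by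
        rw [div_sub_div _ _ (by positivity) (by positivity),
          div_le_div_iff₀ (by positivity) (by positivity)]
        push_cast
        nlinarith [Nat.cast_nonneg (α := ℝ) Y]
      have h3 : ((Y + 1 : ℕ) : ℝ) + 2 = (Y : ℝ) + 3 := by push_cast; ring
      rw [h3]
      rw [show Y + 1 + 1 = Y + 2 from rfl]
      linarith
  refine le_trans (sum_le_sum_of_subset_of_nonneg (Ioc_subset_Ioc_right (by omega : Y ≤ Y + 2))
    fun _ _ _ => by positivity) ((h Y).trans ?_)
  have : 0 ≤ 1 / ((Y : ℝ) + 2) := by positivity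
  linarith

/-- Non-coprime pairs share a divisor `d ≥ 2`, and the sum of `1 / d²` over these is at most `3/4`.
-/
theorem card_coprime_pairs_ge (X Y : ℕ) :
    X * Y ≤ 4 * ((Ioc 0 X ×ˢ Ioc 0 Y).filter (fun p => Nat.Coprime p.1 p.2)).card := by
  have hcover : (Ioc 0 X ×ˢ Ioc 0 Y).filter (fun p => ¬ Nat.Coprime p.1 p.2) ⊆
      (Ioc 1 Y).biUnion (fun d => (Ioc 0 X).filter (fun x => d ∣ x) ×ˢ
        (Ioc 0 Y).filter (fun y => d ∣ y)) := by
    rintro ⟨p, q⟩ h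
    simp only [mem_filter, mem_product, mem_Ioc, mem_biUnion] at h ⊢
    obtain ⟨⟨⟨h1, h2⟩, h3, h4⟩, h5⟩ := h
    have h6 : 0 < Nat.gcd p q := Nat.gcd_pos_of_pos_left _ h1
    have h7 : Nat.gcd p q ≠ 1 := h5
    exact ⟨Nat.gcd p q, ⟨by omega, (Nat.le_of_dvd h3 (Nat.gcd_dvd_right p q)).trans h4⟩,
      ⟨⟨h1, h2⟩, Nat.gcd_dvd_left p q⟩, ⟨h3, h4⟩, Nat.gcd_dvd_right p q⟩
  have hcard : (((Ioc 0 X ×ˢ Ioc 0 Y).filter (fun p => ¬ Nat.Coprime p.1 p.2)).card : ℝ) ≤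
      X * Y * (3 / 4) := by
    calc _ ≤ ((∑ d ∈ Ioc 1 Y, (X / d) * (Y / d) : ℕ) : ℝ) := by
          rw [Nat.cast_le]
          refine (card_le_card hcover).trans (card_biUnion_le.trans (le_of_eq ?_))
          refine sum_congr rfl fun d _ => ?_
          rw [card_product, Nat.Ioc_filter_dvd_card_eq_div, Nat.Ioc_filter_dvd_card_eq_div]
      _ ≤ ∑ d ∈ Ioc 1 Y, X * Y * (1 / (d : ℝ) ^ 2) := by
          push_cast
          refine sum_le_sum fun d _ => ?_
          calc ((X / d : ℕ) : ℝ) * ((Y / d : ℕ) : ℝ) ≤ (X / d) * (Y / d) := by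
                gcongr <;> exact Nat.cast_div_le
            _ = _ := by ring
      _ ≤ _ := by
          rw [← mul_sum]
          gcongr
          exact sum_inv_sq_le Y
  have htot := card_filter_add_card_filter_not (s := Ioc 0 X ×ˢ Ioc 0 Y)
    (fun p => Nat.Coprime p.1 p.2)
  rw [card_product, Nat.card_Ioc, Nat.card_Ioc, Nat.sub_zero, Nat.sub_zero] at htot
  have htot' : (((Ioc 0 X ×ˢ Ioc 0 Y).filter (fun p => Nat.Coprime p.1 p.2)).card : ℝ) +
      ((Ioc 0 X ×ˢ Ioc 0 Y).filter (fun p => ¬ Nat.Coprime p.1 p.2)).card = X * Y := by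
    exact_mod_cast htot
  have : ((X * Y : ℕ) : ℝ) ≤
      ((4 * ((Ioc 0 X ×ˢ Ioc 0 Y).filter (fun p => Nat.Coprime p.1 p.2)).card : ℕ) : ℝ) := by
    push_cast
    linarith
  exact_mod_cast this

/-- Bézout fixes `s` modulo `p`; the window from `2p` to `3p` is chosen so that `s² - nt²` exceeds
`p² - nq²` yet stays `O(p²)`. -/
theorem exists_bezout_column {p q : ℤ} (hq : 0 < q) (hp : 0 < p) (h : IsCoprime p q) :
    ∃ s t : ℤ, p * t - q * s = 1 ∧ 2 * p ≤ s ∧ s ≤ 3 * p ∧ 0 ≤ t ∧ t ≤ 3 * q := by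
  obtain ⟨u, v, huv⟩ := h
  set s := 2 * p + (-v) % p with hs
  have h0 := Int.emod_nonneg (-v) hp.ne'
  have h1 := Int.emod_lt_of_pos (-v) hp
  have h2 := Int.emod_add_mul_ediv (-v) p
  set t := u + q * (2 - (-v) / p) with ht
  have h3 : p * t - q * s = 1 := by
    rw [ht, hs]; linear_combination huv - q * h2
  refine ⟨s, t, h3, by linarith, by linarith, ?_, ?_⟩
  · have : 0 ≤ p * t := by
      have : 0 ≤ q * s := mul_nonneg hq.le (by linarith)
      linarith
    exact nonneg_of_mul_nonneg_right this hp
  · have h4 : q * s ≤ q * (3 * p - 1) := mul_le_mul_of_nonneg_left (by omega) hq.le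
    have h5 : p * t ≤ p * (3 * q) := by linarith
    exact le_of_mul_le_mul_left h5 hp

/-- Size estimates for the pair `(p² - nq², s² - nt²)`. -/
theorem form_bounds {n p q s t : ℤ} (hq : 0 < q) (hpq : (2 * |n| + 2) * q < p)
    (hs1 : 2 * p ≤ s) (hs2 : s ≤ 3 * p) (ht1 : 0 ≤ t) (ht2 : t ≤ 3 * q) :
    7 * p ^ 2 ≤ 8 * (p ^ 2 - n * q ^ 2) ∧ p ^ 2 - n * q ^ 2 < s ^ 2 - n * t ^ 2 ∧
      s ^ 2 - n * t ^ 2 ≤ 18 * p ^ 2 ∧ 0 ≤ p * s - n * q * t := by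
  have hK := abs_nonneg n
  have hp : 0 < p := lt_of_le_of_lt (by positivity) hpq
  have h1 : 8 * (|n| * q ^ 2) ≤ p ^ 2 := by
    have : ((2 * |n| + 2) * q) ^ 2 ≤ p ^ 2 := pow_le_pow_left₀ (by positivity) hpq.le 2
    have h2 : 0 ≤ |n| ^ 2 * q ^ 2 := by positivity
    linarith [sq_nonneg q]
  have hbd : ∀ x : ℤ, 0 ≤ x → -(|n| * x) ≤ n * x ∧ n * x ≤ |n| * x := fun x hx =>
    ⟨by rw [← neg_mul]; exact mul_le_mul_of_nonneg_right (neg_abs_le n) hx,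
      mul_le_mul_of_nonneg_right (le_abs_self n) hx⟩
  obtain ⟨a1, a2⟩ := hbd (q ^ 2) (sq_nonneg q)
  obtain ⟨b1, b2⟩ := hbd (t ^ 2) (sq_nonneg t)
  obtain ⟨c1, c2⟩ := hbd (q * t) (mul_nonneg hq.le ht1)
  have h3 : |n| * t ^ 2 ≤ |n| * (9 * q ^ 2) :=
    mul_le_mul_of_nonneg_left (by nlinarith) hK
  have h4 : |n| * (q * t) ≤ |n| * (3 * q ^ 2) :=
    mul_le_mul_of_nonneg_left (by nlinarith) hK
  have h5 : (2 * p) ^ 2 ≤ s ^ 2 := pow_le_pow_left₀ (by positivity) hs1 2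
  have h6 : s ^ 2 ≤ (3 * p) ^ 2 := pow_le_pow_left₀ (by linarith) hs2 2
  have h7 : p * (2 * p) ≤ p * s := mul_le_mul_of_nonneg_left hs1 hp.le
  have h8 : 0 < p ^ 2 := by positivity
  refine ⟨by linarith, by linarith, by linarith, ?_⟩
  linarith

/-- With `a = p² - nq²` and `r = ps - nqt`, the determinant relation gives `p + qr = at`. Two
representations sharing `a` and `r` thus satisfy `a ∣ pq' - p'q`, a number smaller than `a` in
absolute value, so it vanishes and coprimality finishes. -/
theorem form_injective {n p q s t p' q' s' t' : ℤ} (hq : 0 < q) (hq' : 0 < q')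
    (hp : (2 * |n| + 2) * q < p) (hp' : (2 * |n| + 2) * q' < p') (hcop : IsCoprime p q)
    (hcop' : IsCoprime p' q')
    (h7 : 7 * p ^ 2 ≤ 8 * (p ^ 2 - n * q ^ 2)) (h7' : 7 * p' ^ 2 ≤ 8 * (p' ^ 2 - n * q' ^ 2))
    (hdet : p * t - q * s = 1) (hdet' : p' * t' - q' * s' = 1)
    (ha : p ^ 2 - n * q ^ 2 = p' ^ 2 - n * q' ^ 2)
    (hr : p * s - n * q * t = p' * s' - n * q' * t') : p = p' ∧ q = q' := by
  have hK := abs_nonneg n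
  have hpp : 0 < p := lt_of_le_of_lt (by positivity) hp
  have hpp' : 0 < p' := lt_of_le_of_lt (by positivity) hp'
  set a := p ^ 2 - n * q ^ 2 with hadef
  have h1 : a * t = p + q * (p * s - n * q * t) := by
    rw [hadef]; linear_combination p * hdet
  have h2 : a * t' = p' + q' * (p * s - n * q * t) := by
    rw [hr, ha]; linear_combination p' * hdet'
  have hdvd : a ∣ p * q' - p' * q := ⟨q' * t - q * t', by linear_combination q * h2 - q' * h1⟩
  have h2q : 2 * q ≤ p := by nlinarith
  have h2q' : 2 * q' ≤ p' := by nlinarith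
  have e1 : p * (2 * q') ≤ p * p' := mul_le_mul_of_nonneg_left h2q' hpp.le
  have e2 : p' * (2 * q) ≤ p' * p := mul_le_mul_of_nonneg_left h2q hpp'.le
  have e3 : 0 < p * p' := mul_pos hpp hpp'
  have e4 : 0 < p * q' := mul_pos hpp hq'
  have e5 : 0 < p' * q := mul_pos hpp' hq
  have e6 : 7 * (p * p') ≤ 8 * a := by linarith [sq_nonneg (p - p')]
  have hzero : p * q' - p' * q = 0 := by
    refine Int.eq_zero_of_abs_lt_dvd hdvd ?_
    rw [abs_lt]
    constructor <;> linarith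
  have hd1 : p ∣ p' := hcop.dvd_of_dvd_mul_right ⟨q', by linarith⟩
  have hd2 : p' ∣ p := hcop'.dvd_of_dvd_mul_right ⟨q, by linarith⟩
  have hpe : p = p' := le_antisymm (Int.le_of_dvd hpp' hd1) (Int.le_of_dvd hpp hd2)
  refine ⟨hpe, ?_⟩
  rw [← hpe, ← mul_sub] at hzero
  have := (mul_eq_zero.1 hzero).resolve_left hpp.ne'
  linarith

/-- By Brahmagupta's identity, `pt - qs = 1` gives `(p² - nq²)(s² - nt²) + n = (ps - nqt)²`. With `p
≤ 8BY` both entries are at most `18(8BY)² = 1152B²Y²`. -/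
theorem card_pairSet_ge {n : ℤ} {N Y : ℕ}
    (hN : 1152 * (2 * n.natAbs + 2) ^ 2 * Y ^ 2 ≤ N) :
    (2 * n.natAbs + 2) * Y ^ 2 ≤ (pairSet n N).card := by
  classical
  set B := 2 * n.natAbs + 2 with hB
  have hBn : (B : ℤ) = 2 * |n| + 2 := by rw [hB]; push_cast; rfl
  set G := ((Ioc 0 (8 * B * Y) ×ˢ Ioc 0 Y).filter (fun p => Nat.Coprime p.1 p.2)).filter
    (fun p => ¬ p.1 ≤ B * Y) with hG
  -- At least a quarter of the `8BY · Y` points are coprime, and at most `BY · Y` of them have `p ≤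
  -- BY`.
  have hGcard : B * Y ^ 2 ≤ G.card := by
    have h1 := card_coprime_pairs_ge (8 * B * Y) Y
    have h2 := card_filter_add_card_filter_not
      (s := (Ioc 0 (8 * B * Y) ×ˢ Ioc 0 Y).filter (fun p => Nat.Coprime p.1 p.2))
      (fun p => p.1 ≤ B * Y)
    have h3 : (((Ioc 0 (8 * B * Y) ×ˢ Ioc 0 Y).filter (fun p => Nat.Coprime p.1 p.2)).filter
        (fun p => p.1 ≤ B * Y)).card ≤ B * Y * Y := by
      have : ((Ioc 0 (8 * B * Y) ×ˢ Ioc 0 Y).filter (fun p => Nat.Coprime p.1 p.2)).filter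
        (fun p => p.1 ≤ B * Y) ⊆ Ioc 0 (B * Y) ×ˢ Ioc 0 Y := by
        intro p hp
        simp only [mem_filter, mem_product, mem_Ioc] at hp ⊢
        tauto
      simpa using card_le_card this
    rw [← hG] at h2
    nlinarith
  have hGmem : ∀ p ∈ G, 0 < (p.2 : ℤ) ∧ (2 * |n| + 2) * (p.2 : ℤ) < p.1 ∧
      IsCoprime (p.1 : ℤ) (p.2 : ℤ) ∧ p.1 ≤ 8 * B * Y := by
    intro p hp
    simp only [hG, mem_filter, mem_product, mem_Ioc, not_le] at hp
    obtain ⟨⟨⟨⟨h1, h2⟩, h3, h4⟩, h5⟩, h6⟩ := hp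
    refine ⟨by exact_mod_cast h3, ?_, Nat.isCoprime_iff_coprime.2 h5, h2⟩
    rw [← hBn]
    exact_mod_cast lt_of_le_of_lt (Nat.mul_le_mul_left B h4) h6
  have hcol : ∀ p : ℕ × ℕ, ∃ st : ℤ × ℤ, p ∈ G → (p.1 : ℤ) * st.2 - p.2 * st.1 = 1 ∧
      2 * (p.1 : ℤ) ≤ st.1 ∧ st.1 ≤ 3 * p.1 ∧ 0 ≤ st.2 ∧ st.2 ≤ 3 * p.2 := by
    intro p
    by_cases hp : p ∈ G
    · obtain ⟨h1, h2, h3, -⟩ := hGmem p hp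
      obtain ⟨s, t, h⟩ := exists_bezout_column h1
        (lt_of_le_of_lt (by positivity) h2) h3
      exact ⟨(s, t), fun _ => h⟩
    · exact ⟨(0, 0), fun h => absurd h hp⟩
  choose st hst using hcol
  have hall : ∀ p ∈ G, ∃ a b : ℕ, (a : ℤ) = (p.1 : ℤ) ^ 2 - n * (p.2 : ℤ) ^ 2 ∧
      (b : ℤ) = (st p).1 ^ 2 - n * (st p).2 ^ 2 ∧ 0 < a ∧ a < b ∧ b ≤ N := by
    intro p hp
    obtain ⟨h1, h2, h3, h4⟩ := hGmem p hp
    obtain ⟨k1, k2, k3, k4, k5⟩ := hst p hp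
    obtain ⟨f1, f2, f3, -⟩ := form_bounds h1 h2 k2 k3 k4 k5
    have hp0 : 0 < (p.1 : ℤ) := lt_of_le_of_lt (by positivity) h2
    have hp2 : 0 < (p.1 : ℤ) ^ 2 := by positivity
    obtain ⟨a, ha⟩ := Int.eq_ofNat_of_zero_le (by linarith : 0 ≤ (p.1 : ℤ) ^ 2 - n * (p.2 : ℤ) ^ 2)
    obtain ⟨b, hb⟩ := Int.eq_ofNat_of_zero_le (by linarith : 0 ≤ (st p).1 ^ 2 - n * (st p).2 ^ 2)
    rw [ha, hb] at f2
    rw [hb] at f3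
    rw [ha] at f1
    refine ⟨a, b, ha.symm, hb.symm, by omega, by omega, ?_⟩
    have h5 : p.1 ^ 2 ≤ (8 * B * Y) ^ 2 := Nat.pow_le_pow_left h4 2
    have h6 : b ≤ 18 * p.1 ^ 2 := by exact_mod_cast f3
    linarith
  refine hGcard.trans (card_le_card_of_injOn (fun p => (((p.1 : ℤ) ^ 2 - n * (p.2 : ℤ) ^ 2).toNat,
    ((st p).1 ^ 2 - n * (st p).2 ^ 2).toNat)) ?_ ?_)
  · intro p hp
    obtain ⟨a, b, ha, hb, h1, h2, h3⟩ := hall p hp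
    simp only [← ha, ← hb, Int.toNat_natCast]
    refine mem_pairSet.2 ⟨h1, h2, h3, (p.1 : ℤ) * (st p).1 - n * p.2 * (st p).2, ?_⟩
    rw [ha, hb]
    linear_combination -n * ((p.1 : ℤ) * (st p).2 - p.2 * (st p).1 + 1) * (hst p hp).1
  · intro p hp p' hp' heq
    obtain ⟨a, b, ha, hb, -⟩ := hall p hp
    obtain ⟨a', b', ha', hb', -⟩ := hall p' hp'
    simp only [← ha, ← hb, ← ha', ← hb', Int.toNat_natCast, Prod.mk.injEq] at heq
    obtain ⟨rfl, rfl⟩ := heq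
    obtain ⟨h1, h2, h3, -⟩ := hGmem p hp
    obtain ⟨h1', h2', h3', -⟩ := hGmem p' hp'
    obtain ⟨k1, k2, k3, k4, k5⟩ := hst p hp
    obtain ⟨k1', k2', k3', k4', k5'⟩ := hst p' hp'
    obtain ⟨f1, -, -, f4⟩ := form_bounds h1 h2 k2 k3 k4 k5
    obtain ⟨f1', -, -, f4'⟩ := form_bounds h1' h2' k2' k3' k4' k5'
    have hr : ∀ x y z w : ℤ, x * w - y * z = 1 →
        (x * z - n * y * w) ^ 2 = (x ^ 2 - n * y ^ 2) * (z ^ 2 - n * w ^ 2) + n := by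
      intro x y z w h
      linear_combination n * (x * w - y * z + 1) * h
    have hreq : (p.1 : ℤ) * (st p).1 - n * p.2 * (st p).2 =
        (p'.1 : ℤ) * (st p').1 - n * p'.2 * (st p').2 := by
      refine (sq_eq_sq₀ f4 f4').1 ?_
      rw [hr _ _ _ _ k1, hr _ _ _ _ k1', ← ha, ← hb, ← ha', ← hb']
    have := form_injective h1 h1' h2 h2' h3 h3' f1 f1' k1 k1' (ha.symm.trans ha') hreq
    exact Prod.ext (by exact_mod_cast this.1) (by exact_mod_cast this.2)

theorem exists_linear_lower_bound (n : ℤ) :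
    ∃ c : ℝ, 0 < c ∧ ∀ᶠ N : ℕ in Filter.atTop, c * N ≤ ((pairSet n N).card : ℝ) := by
  set B := 2 * n.natAbs + 2 with hB
  refine ⟨1 / (4608 * B), by positivity, ?_⟩
  filter_upwards [Filter.eventually_ge_atTop (1152 * B ^ 2)] with N hN
  have hB0 : 0 < 1152 * B ^ 2 := by positivity
  set Y := Nat.sqrt (N / (1152 * B ^ 2)) with hY
  have h1 : 1152 * B ^ 2 * Y ^ 2 ≤ N := by
    have h := Nat.sqrt_le' (N / (1152 * B ^ 2))
    calc _ ≤ 1152 * B ^ 2 * (N / (1152 * B ^ 2)) := Nat.mul_le_mul_left _ h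
      _ ≤ N := Nat.mul_div_le _ _
  have hY1 : 1 ≤ Y := Nat.le_sqrt'.2 (by
    rw [one_pow, Nat.le_div_iff_mul_le hB0, one_mul]; exact hN)
  have h2 : N ≤ 1152 * B ^ 2 * (4 * Y ^ 2) := by
    have h := Nat.lt_succ_sqrt' (N / (1152 * B ^ 2))
    rw [Nat.div_lt_iff_lt_mul hB0, ← hY] at h
    have h3 : (Y + 1) ^ 2 ≤ 4 * Y ^ 2 := by nlinarith
    calc N ≤ (Y + 1) ^ 2 * (1152 * B ^ 2) := h.le
      _ ≤ _ := by rw [mul_comm]; exact Nat.mul_le_mul_left _ h3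
  have h3 := card_pairSet_ge h1
  have h2' : (N : ℝ) ≤ 1152 * B ^ 2 * (4 * Y ^ 2) := by exact_mod_cast h2
  have h3' : (B : ℝ) * Y ^ 2 ≤ (pairSet n N).card := by exact_mod_cast h3
  refine le_trans ?_ h3'
  rw [div_mul_eq_mul_div, one_mul, div_le_iff₀ (by positivity)]
  linarith

/-! ### Superlinear lower bound when `n` is a square -/

theorem exists_residue {p v : ℕ} (hp : p.Prime) (h1 : p < v) (h2 : v < 2 * p) (m : ℕ) :
    ∃ c, 0 < c ∧ c ≤ p ∧ p ∣ c * v + m := by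
  have hcop : Nat.Coprime v p := by
    rw [Nat.coprime_comm, hp.coprime_iff_not_dvd]
    rintro ⟨d, rfl⟩
    have h3 : 1 < d := by
      by_contra! h
      nlinarith
    nlinarith
  obtain ⟨w, hw⟩ := (Nat.isCoprime_iff_coprime.2 hcop)
  obtain ⟨z, hz⟩ := hw
  have hp0 : 0 < (p : ℤ) := by exact_mod_cast hp.pos
  have e0 := Int.emod_nonneg (-(w * m) - 1) hp0.ne'
  have e1 := Int.emod_lt_of_pos (-(w * m) - 1) hp0
  have e2 := Int.emod_add_mul_ediv (-(w * m) - 1) p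
  obtain ⟨c, hc⟩ := Int.eq_ofNat_of_zero_le e0
  -- The shift by one takes the residue in `1, …, p` instead of `0, …, p - 1`, which later keeps `u`
  -- positive.
  refine ⟨c + 1, by omega, by omega, ?_⟩
  zify
  refine ⟨m * z - v * ((-(w * m) - 1) / p), ?_⟩
  rw [hc] at e2
  linear_combination -(m : ℤ) * hz + v * e2

/-- A lower bound for the number of `D(k²)`-pairs from factorizations attached to primes. -/
theorem sum_primes_le_card_pairSet {k : ℕ} (S : Finset Nat.Primes) (N : ℕ) :
    ∑ p ∈ S, ((p : ℕ) - 1) * ((N - 4 * k) / (4 * p * p)) ≤ (pairSet ((k : ℤ) ^ 2) N).card := by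
  classical
  have hres : ∀ (p : Nat.Primes) (v : ℕ), ∃ c : ℕ, (p : ℕ) < v → v < 2 * (p : ℕ) →
      0 < c ∧ c ≤ (p : ℕ) ∧ (p : ℕ) ∣ c * v + 2 * k := by
    intro p v
    by_cases h : (p : ℕ) < v ∧ v < 2 * (p : ℕ)
    · obtain ⟨c, hc⟩ := exists_residue p.2 h.1 h.2 (2 * k)
      exact ⟨c, fun _ _ => hc⟩
    · exact ⟨0, fun h1 h2 => absurd ⟨h1, h2⟩ h⟩
  choose c hc using hres
  set F : Finset (Σ p : Nat.Primes, ℕ × ℕ) := S.sigma (fun p =>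
    Ioo (p : ℕ) (2 * p) ×ˢ range ((N - 4 * k) / (4 * p * p))) with hF
  have hcard : F.card = ∑ p ∈ S, ((p : ℕ) - 1) * ((N - 4 * k) / (4 * p * p)) := by
    rw [hF, card_sigma]
    refine sum_congr rfl fun p _ => ?_
    rw [card_product, Nat.card_Ioo, card_range]
    congr 1
    omega
  -- The pair is `(up, vz)` with `uv + 2k = pz`, so `up · vz + k² = (uv + k)²`; `u` runs over the
  -- residue class modulo `p` making `z` integral.
  set u : (Σ _ : Nat.Primes, ℕ × ℕ) → ℕ := fun x => x.2.2 * x.1 + c x.1 x.2.1 with hu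
  set z : (Σ _ : Nat.Primes, ℕ × ℕ) → ℕ := fun x => (u x * x.2.1 + 2 * k) / x.1 with hz
  have hprop : ∀ x ∈ F, (x.1 : ℕ) < x.2.1 ∧ x.2.1 < 2 * x.1 ∧ 0 < u x ∧
      4 * (x.1 : ℕ) * u x + 4 * k ≤ N ∧ z x * x.1 = u x * x.2.1 + 2 * k := by
    rintro ⟨p, v, j⟩ hx
    simp only [hF, mem_sigma, mem_product, mem_Ioo, mem_range] at hx
    obtain ⟨-, ⟨h1, h2⟩, h3⟩ := hx
    obtain ⟨c1, c2, c3⟩ := hc p v h1 h2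
    have hp := p.2.pos
    refine ⟨h1, h2, by simp only [hu]; omega, ?_, ?_⟩
    · have h4 : (j + 1) * (4 * p * p) ≤ N - 4 * k :=
        (Nat.le_div_iff_mul_le (by positivity)).1 h3
      have h5 : 0 < (j + 1) * (4 * (p : ℕ) * p) := by positivity
      have h6 : (j + 1) * (4 * (p : ℕ) * p) + 4 * k ≤ N := by omega
      have h7 : 4 * (p : ℕ) * (j * p + c p v) ≤ (j + 1) * (4 * p * p) := by
        have : 4 * (p : ℕ) * c p v ≤ 4 * p * p := Nat.mul_le_mul_left _ c2
        linarith
      simp only [hu]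
      omega
    · refine Nat.div_mul_cancel ?_
      simp only [hu]
      have : (p : ℕ) ∣ j * v * p + (c p v * v + 2 * k) := (dvd_mul_left _ _).add c3
      exact this.trans (dvd_of_eq (by ring))
  rw [← hcard]
  refine card_le_card_of_injOn (fun x => (u x * x.1, x.2.1 * z x)) ?_ ?_
  · intro x hx
    obtain ⟨h1, h2, h3, h4, h5⟩ := hprop x hx
    have hp := x.1.2.pos
    refine mem_pairSet.2 ⟨by positivity, ?_, ?_, (u x : ℤ) * x.2.1 + k, ?_⟩
    · refine lt_of_mul_lt_mul_right (a := (x.1 : ℕ)) ?_ (Nat.zero_le _)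
      rw [mul_assoc x.2.1, h5]
      have h6 : (x.1 : ℕ) * x.1 < x.2.1 * x.2.1 := Nat.mul_lt_mul'' h1 h1
      have h7 : u x * (x.1 * x.1) < u x * (x.2.1 * x.2.1) := Nat.mul_lt_mul_of_pos_left h6 h3
      nlinarith
    · refine le_trans ?_ h4
      refine le_of_mul_le_mul_right (a := (x.1 : ℕ)) ?_ hp
      rw [mul_assoc x.2.1, h5]
      calc x.2.1 * (u x * x.2.1 + 2 * k) ≤ (2 * x.1) * (u x * (2 * x.1) + 2 * k) := by gcongr
        _ = _ := by ring
    · have h5' : (z x : ℤ) * x.1 = u x * x.2.1 + 2 * k := by exact_mod_cast h5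
      push_cast
      linear_combination (u x : ℤ) * x.2.1 * h5'
  · intro x hx y hy heq
    obtain ⟨h1, h2, h3, h4, h5⟩ := hprop x hx
    obtain ⟨h1', h2', h3', h4', h5'⟩ := hprop y hy
    simp only [Prod.mk.injEq] at heq
    obtain ⟨e1, e2⟩ := heq
    have hsq : ∀ w : Σ _ : Nat.Primes, ℕ × ℕ, z w * w.1 = u w * w.2.1 + 2 * k →
        (u w * w.2.1 + k) ^ 2 = (u w * w.1) * (w.2.1 * z w) + k ^ 2 := by
      intro w hw
      calc (u w * w.2.1 + k) ^ 2 = (u w * w.2.1) * (u w * w.2.1 + 2 * k) + k ^ 2 := by ring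
        _ = _ := by rw [← hw]; ring
    have e3 : u x * x.2.1 = u y * y.2.1 := by
      have : (u x * x.2.1 + k) ^ 2 = (u y * y.2.1 + k) ^ 2 := by
        rw [hsq x h5, hsq y h5', e1, e2]
      have := Nat.pow_left_injective two_ne_zero this
      omega
    -- The pair determines `up` and `uv`; as `p` and `v` are coprime, `u` is their gcd, and then
    -- `p`, `v` and `j` follow.
    have hgcd : ∀ w : Σ _ : Nat.Primes, ℕ × ℕ, (w.1 : ℕ) < w.2.1 → w.2.1 < 2 * w.1 →
        Nat.gcd (u w * w.1) (u w * w.2.1) = u w := by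
      intro w hw1 hw2
      have : Nat.Coprime w.1 w.2.1 := by
        rw [w.1.2.coprime_iff_not_dvd]
        rintro ⟨d, hd⟩
        rw [hd] at hw1 hw2
        have h3 : 1 < d := by
          by_contra! h
          nlinarith
        nlinarith
      rw [Nat.gcd_mul_left, this, mul_one]
    have e4 : u x = u y := by
      rw [← hgcd x h1 h2, ← hgcd y h1' h2', e1, e3]
    rw [e4] at e1 e3
    have e5 := Nat.eq_of_mul_eq_mul_left h3' e1
    have e6 := Nat.eq_of_mul_eq_mul_left h3' e3
    obtain ⟨p, v, j⟩ := x
    obtain ⟨p', v', j'⟩ := y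
    simp only at e5 e6
    have e7 : p = p' := Subtype.ext e5
    subst e7 e6
    have e8 : j * (p : ℕ) + c p v = j' * p + c p v := e4
    have e9 : j = j' := Nat.eq_of_mul_eq_mul_right p.2.pos (by omega)
    rw [e9]

/-- A prime `p` contributes at least `N / (8p) - (k + p)` pairs, and the sum of `1/p` diverges. -/
theorem eventually_mul_le_card_pairSet {k : ℕ} (K : ℝ) :
    ∀ᶠ N : ℕ in Filter.atTop, K * N ≤ ((pairSet ((k : ℤ) ^ 2) N).card : ℝ) := by
  obtain ⟨S, hS⟩ : ∃ S : Finset Nat.Primes, 8 * (K + 1) < ∑ p ∈ S, (1 / (p : ℕ) : ℝ) := by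
    by_contra! h
    exact Nat.Primes.not_summable_one_div
      (summable_of_sum_le (fun _ => by positivity) h)
  set C : ℝ := ∑ p ∈ S, ((k : ℝ) + (p : ℕ)) with hC
  filter_upwards [Filter.eventually_ge_atTop (max (4 * k) ⌈C⌉₊)] with N hN
  have hN1 : 4 * k ≤ N := (le_max_left _ _).trans hN
  have hN2 : C ≤ N := (Nat.le_ceil C).trans (by exact_mod_cast (le_max_right _ _).trans hN)
  have h1 : ((∑ p ∈ S, ((p : ℕ) - 1) * ((N - 4 * k) / (4 * p * p)) : ℕ) : ℝ) ≤
      (pairSet ((k : ℤ) ^ 2) N).card := by exact_mod_cast sum_primes_le_card_pairSet S N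
  have h2 : ∑ p ∈ S, ((N : ℝ) / 8 * (1 / (p : ℕ)) - (k + (p : ℕ))) ≤
      ((∑ p ∈ S, ((p : ℕ) - 1) * ((N - 4 * k) / (4 * p * p)) : ℕ) : ℝ) := by
    push_cast
    refine sum_le_sum fun p _ => ?_
    have hp2 : (2 : ℝ) ≤ (p : ℕ) := by exact_mod_cast p.2.two_le
    have hp0 : (0 : ℝ) < (p : ℕ) := by linarith
    have h3 : ((N : ℝ) - 4 * k) / (4 * (p : ℕ) * (p : ℕ)) - 1 ≤
        (((N - 4 * k) / (4 * p * p) : ℕ) : ℝ) := by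
      have h4 := Nat.lt_div_mul_add (a := N - 4 * k) (b := 4 * p * p)
        (by have := p.2.pos; positivity)
      have h5 : ((N - 4 * k : ℕ) : ℝ) = (N : ℝ) - 4 * k := by
        rw [Nat.cast_sub hN1]; push_cast; ring
      rw [← h5, sub_le_iff_le_add, div_le_iff₀ (by positivity)]
      have h6 : ((N - 4 * k : ℕ) : ℝ) ≤ (((N - 4 * k) / (4 * p * p) * (4 * p * p) + 4 * p * p : ℕ) : ℝ) := by
        exact_mod_cast h4.le
      refine h6.trans (le_of_eq ?_)
      push_cast
      ring
    have h7 : (((p : ℕ) - 1 : ℕ) : ℝ) = (p : ℕ) - 1 := by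
      rw [Nat.cast_sub p.2.one_le, Nat.cast_one]
    rw [h7]
    set m := (((N - 4 * k) / (4 * p * p) : ℕ) : ℝ) with hm
    have hm0 : 0 ≤ m := by positivity
    calc (N : ℝ) / 8 * (1 / (p : ℕ)) - (k + (p : ℕ))
        ≤ (p : ℕ) / 2 * (((N : ℝ) - 4 * k) / (4 * (p : ℕ) * (p : ℕ)) - 1) := by
          have h8 : (p : ℕ) / 2 * (((N : ℝ) - 4 * k) / (4 * (p : ℕ) * (p : ℕ)) - 1) =
              (N : ℝ) / 8 * (1 / (p : ℕ)) - (k / (2 * (p : ℕ)) + (p : ℕ) / 2) := by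
            field_simp
            ring
          have h9 : (k : ℝ) / (2 * (p : ℕ)) ≤ k :=
            div_le_self (by positivity) (by linarith)
          rw [h8]
          linarith
      _ ≤ (p : ℕ) / 2 * m := by gcongr
      _ ≤ ((p : ℕ) - 1) * m := by gcongr; linarith
  have h3 : ∑ p ∈ S, ((N : ℝ) / 8 * (1 / (p : ℕ)) - (k + (p : ℕ))) =
      (N : ℝ) / 8 * ∑ p ∈ S, (1 / (p : ℕ) : ℝ) - C := by
    rw [sum_sub_distrib, ← mul_sum]
  have h4 : (N : ℝ) / 8 * (8 * (K + 1)) ≤ (N : ℝ) / 8 * ∑ p ∈ S, (1 / (p : ℕ) : ℝ) := by gcongr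
  linarith

/-! ### Asymptotic conclusions -/

open Filter Asymptotics

theorem natCast_isBigO_tupleCount_two (n : ℤ) :
    (fun N : ℕ => (N : ℝ)) =O[atTop] (fun N : ℕ => (tupleCount 2 n N : ℝ)) := by
  obtain ⟨c, hc, h⟩ := exists_linear_lower_bound n
  refine IsBigO.of_bound (1 / c) ?_
  filter_upwards [h] with N hN
  rw [Real.norm_of_nonneg (by positivity), Real.norm_of_nonneg (by positivity),
    div_mul_eq_mul_div, one_mul, le_div_iff₀ hc, ← card_pairSet]
  linarith

theorem natCast_isLittleO_tupleCount_two {n : ℤ} (h : IsSquare n) :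
    (fun N : ℕ => (N : ℝ)) =o[atTop] (fun N : ℕ => (tupleCount 2 n N : ℝ)) := by
  obtain ⟨m, hm⟩ := h
  have hk : n = ((m.natAbs : ℕ) : ℤ) ^ 2 := by rw [hm, Int.natCast_natAbs, sq_abs, sq]
  refine IsLittleO.of_bound fun c hc => ?_
  filter_upwards [eventually_mul_le_card_pairSet (k := m.natAbs) (1 / c)] with N hN
  rw [← hk, card_pairSet] at hN
  rw [Real.norm_of_nonneg (by positivity), Real.norm_of_nonneg (by positivity)]
  rw [div_mul_eq_mul_div, one_mul, div_le_iff₀ hc] at hN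
  linarith

theorem const_isLittleO_tupleCount_two (n : ℤ) (C : ℝ) :
    (fun _ : ℕ => C) =o[atTop] (fun N : ℕ => (tupleCount 2 n N : ℝ)) := by
  refine IsLittleO.trans_isBigO ?_ (natCast_isBigO_tupleCount_two n)
  exact (isLittleO_const_id_atTop C).comp_tendsto tendsto_natCast_atTop_atTop

/-- The linear error is present only for square `n`, exactly where pairs are known to be
superlinear; otherwise the error is constant. -/
theorem regular_isEquivalent {n : ℤ} (hn : n ≠ 0) :
    (fun N : ℕ => (regularTripleCount n N : ℝ)) ~[atTop]
      (fun N : ℕ => (tupleCount 2 n N : ℝ) / 2) := by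
  classical
  have herr : (fun N : ℕ => (((2 * n.natAbs + 1) ^ 2 : ℕ) : ℝ) + if IsSquare n then (N : ℝ) else 0)
      =o[atTop] (fun N : ℕ => (tupleCount 2 n N : ℝ)) := by
    refine (const_isLittleO_tupleCount_two n _).add ?_
    split_ifs with h
    · exact natCast_isLittleO_tupleCount_two h
    · exact isLittleO_zero _ _
  have hdiff : (fun N : ℕ => (regularTripleCount n N : ℝ) - (tupleCount 2 n N : ℝ) / 2)
      =O[atTop] (fun N : ℕ => (((2 * n.natAbs + 1) ^ 2 : ℕ) : ℝ) +
        if IsSquare n then (N : ℝ) else 0) := by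
    refine IsBigO.of_bound 1 (Eventually.of_forall fun N => ?_)
    have h1 := two_mul_card_regSet_le n N
    have h2 := card_pairSet_le n hn N
    rw [card_regSet, card_pairSet] at h1 h2
    have h1' : 2 * (regularTripleCount n N : ℝ) ≤ tupleCount 2 n N := by exact_mod_cast h1
    have h2' : (tupleCount 2 n N : ℝ) ≤ 2 * regularTripleCount n N +
        (((2 * n.natAbs + 1) ^ 2 : ℕ) : ℝ) + if IsSquare n then (N : ℝ) else 0 := by
      split_ifs at h2 ⊢ <;> exact_mod_cast h2
    have h0 : (0 : ℝ) ≤ (((2 * n.natAbs + 1) ^ 2 : ℕ) : ℝ) + if IsSquare n then (N : ℝ) else 0 := by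
      split_ifs <;> positivity
    rw [Real.norm_of_nonneg h0, Real.norm_of_nonpos (by linarith)]
    linarith
  have h := hdiff.trans_isLittleO herr
  have h2 : (fun N : ℕ => (tupleCount 2 n N : ℝ)) =O[atTop]
      (fun N : ℕ => (tupleCount 2 n N : ℝ) / 2) := by
    refine IsBigO.of_bound 2 (Eventually.of_forall fun N => ?_)
    rw [Real.norm_of_nonneg (by positivity), Real.norm_of_nonneg (by positivity)]
    linarith
  exact h.trans_isBigO h2

theorem irregular_isLittleO {n : ℤ} (hn : n ≠ 0) :
    (fun N : ℕ => (irregularTripleCount n N : ℝ)) =o[atTop]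
      (fun N : ℕ => (tupleCount 2 n N : ℝ)) := by
  refine ((irregularTripleCount_isBigO hn).trans_isLittleO ?_).trans_isBigO (natCast_isBigO_tupleCount_two n)
  have h : (fun x : ℝ => x ^ (0.52 : ℝ)) =o[atTop] (fun x : ℝ => x) := by
    refine isLittleO_of_tendsto' ?_ ?_
    · filter_upwards [eventually_gt_atTop 0] with x hx h0
      exact absurd h0 hx.ne'
    · refine (tendsto_rpow_neg_atTop (y := 0.48) (by norm_num)).congr' ?_
      filter_upwards [eventually_gt_atTop 0] with x hx
      rw [← Real.rpow_sub_one hx.ne']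
      norm_num
  exact h.comp_tendsto tendsto_natCast_atTop_atTop

theorem tupleCount_three_isEquivalent {n : ℤ} (hn : n ≠ 0) :
    (fun N : ℕ => (tupleCount 3 n N : ℝ)) ~[atTop]
      (fun N : ℕ => (regularTripleCount n N : ℝ)) := by
  have h1 : (fun N : ℕ => (tupleCount 2 n N : ℝ)) =O[atTop]
      (fun N : ℕ => (tupleCount 2 n N : ℝ) / 2) := by
    refine IsBigO.of_bound 2 (Eventually.of_forall fun N => ?_)
    rw [Real.norm_of_nonneg (by positivity), Real.norm_of_nonneg (by positivity)]
    linarith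
  have h := (irregular_isLittleO hn).trans_isBigO
    (h1.trans (regular_isEquivalent hn).symm.isBigO)
  have h2 : (fun N : ℕ => (tupleCount 3 n N : ℝ)) =
      (fun N : ℕ => (regularTripleCount n N : ℝ)) +
        (fun N : ℕ => (irregularTripleCount n N : ℝ)) := by
    ext N
    simp [tupleCount_three_eq]
  rw [h2]
  exact IsEquivalent.refl.add_isLittleO h

end DTuples

theorem theorem3 (n : ℤ) (hn : n ≠ 0) :
    Asymptotics.IsEquivalent Filter.atTop
      (fun N : ℕ => (DTuples.tupleCount 3 n N : ℝ))
      (fun N : ℕ => (DTuples.regularTripleCount n N : ℝ)) ∧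
    Asymptotics.IsEquivalent Filter.atTop
      (fun N : ℕ => (DTuples.regularTripleCount n N : ℝ))
      (fun N : ℕ => (DTuples.tupleCount 2 n N : ℝ) / 2) ∧
    Asymptotics.IsEquivalent Filter.atTop
      (fun N : ℕ => (DTuples.tupleCount 3 n N : ℝ))
      (fun N : ℕ => (DTuples.tupleCount 2 n N : ℝ) / 2) ∧
    Asymptotics.IsBigO Filter.atTop
      (fun N : ℕ => (DTuples.irregularTripleCount n N : ℝ))
      (fun N : ℕ => (N : ℝ) ^ (0.52 : ℝ)) :=
  ⟨DTuples.tupleCount_three_isEquivalent hn, DTuples.regular_isEquivalent hn,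
    (DTuples.tupleCount_three_isEquivalent hn).trans (DTuples.regular_isEquivalent hn),
    DTuples.irregularTripleCount_isBigO hn⟩
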